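/- **Theorem (General transformation, uncoupled environments).** *Model.* Let $Z=(Z_1,\dots,Z_n)$ be a latent vector and $\mathcal G$ a DAG on $[n]$ with parent sets $\mathrm{Pa}(i)$. The density of $Z$ in the observational environment is $p(z)=\prod_{i}p_i(z_i\mid z_{\mathrm{Pa}(i)})$, where the conditional densities $p_i$ are strictly positive, continuously differentiable in all variables, and $p_i$ genuinely depends on $z_k$ for every $k\in \mathrm{Pa}(i)$. The observed vector is $X=g(Z)\in\mathbb R^d$, where $g:\mathbb R^n\to\mathbb R^d$ is an unknown $C^1$ diffeomorphism onto its image $\mathcal X=g(\mathbb R^n)$. For each node $i$ let $q_i,\tilde q_i$ be two strictly positive $C^1$ probability densities on $\mathbb R$ (hard intervention mechanisms), and let $I,\tilde I$ be two unknown permutations of $[n]$. In environment $\mathcal E^m$ the factor $p_{\ell}$, $\ell=I(m)$, is replaced by $q_\ell(z_\ell)$; in environment $\tilde{\mathcal E}^m$ the factor $p_\ell$, $\ell=\tilde I(m)$, is replaced by $\tilde q_\ell(z_\ell)$. Two densities $a,b$ on $\mathbb R$ satisfy *interventional discrepancy* if $(a/b)'(u)\neq0$ for Lebesgue-almost every $u$.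 Assume that for every $i$ the pairs $(p_i(\cdot\mid w),q_i)$ and $(p_i(\cdot\mid w),\tilde q_i)$, for all parent values $w$, and the pair $(q_i,\tilde q_i)$ satisfy interventional discrepancy. *Identifiability.* There is an estimator, i.e. a function of $\mathcal X$ and of the laws of $X$ in the environments $\mathcal E^0$ (observational), $\mathcal E^1,\dots,\mathcal E^n,\tilde{\mathcal E}^1,\dots,\tilde{\mathcal E}^n$ alone, with values $(\hat h,\hat{\mathcal G})$, $\hat h:\mathbb R^d\to\mathbb R^n$ and $\hat{\mathcal G}$ a directed graph on $[n]$, such that for every such model there are a permutation $\tau$ of $[n]$ and $C^1$ diffeomorphisms $\phi_i:\mathbb R\to\mathbb R$ with 1. $i\to m$ in $\hat{\mathcal G}$ if and only if $\tau(i)\to\tau(m)$ in $\mathcal G$ (perfect DAG recovery); 2. $[\hat h(g(z))]_m=\phi_{\tau(m)}(z_{\tau(m)})$ for all $z\in\mathbb R^n$ and $m\in[n]$ (componentwise latent recovery). *Optimisation problem.* Let $\mathcal H$ be the set of $h$ that restrict to a $C^1$ diffeomorphism of $\mathcal X$ onto $\mathbb R^n$. For $h\in\mathcal H$ put $\hat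 Z=h(X)$, and let $s_{\hat Z},s^m_{\hat Z},\tilde s^m_{\hat Z}$ be the scores (gradients of the log-density) of $\hat Z$ under $\mathcal E^0,\mathcal E^m,\tilde{\mathcal E}^m$; a difference of two scores is read as the gradient of the difference of the log-densities. With expectations, possibly infinite, under the observational law, put $[D(h)]_{i,m}=\mathbb E|s_{\hat Z}(\hat Z)-s^m_{\hat Z}(\hat Z)|_i$, $[\tilde D(h)]_{i,m}=\mathbb E|s_{\hat Z}(\hat Z)-\tilde s^m_{\hat Z}(\hat Z)|_i$ and $[D_{\rm t}(h;\pi)]_{i,m}=\mathbb E|s^m_{\hat Z}(\hat Z)-\tilde s^{\pi_m}_{\hat Z}(\hat Z)|_i$. Let $\mathbb 1\{A\}$ be the matrix of indicators of the nonzero entries of $A$, let $P_\pi$ be the permutation matrix with entries $[P_\pi]_{m,\pi_m}=1$, and let $\odot$ be the entrywise product. For $\lambda\ge0$ consider, over $h\in\mathcal H$, measurable decoders $r:\mathbb R^n\to\mathbb R^d$ and permutations $\pi$ of $[n]$, $$\min_{h,r,\pi}\ \|D_{\rm t}(h;\pi)-\mathrm{Id}\|_F^2+\lambda\,\mathbb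 E\|r(h(X))-X\|_2^2\quad\text{s.t.}\quad \mathbb 1\{D(h)\}=\mathbb 1\{\tilde D(h)\}P_\pi^\top,\qquad \mathbb 1\{D(h)\}\odot\mathbb 1\{D(h)\}^\top=\mathrm{Id}.$$ For every model as above and every $\lambda\ge 0$ the minimum is attained and equals $0$, and every minimiser $(h,r,\pi)$ satisfies: $\tilde I(\pi_m)=I(m)$ for all $m$ (correct coupling); $\hat h=h$ satisfies 2 with $\tau=I$; and the graph $\hat{\mathcal G}$ with parent sets $\hat{\mathrm{Pa}}(m)=\{i\ne m:[D(h)]_{i,m}\neq0\}$ satisfies 1 with $\tau=I$. -/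

import Mathlib

open MeasureTheory
open scoped ENNReal Matrix Manifold ContDiff

noncomputable section

namespace CRL

/-- The space `ℝᵈ` of the observed vector `X`. -/
abbrev Obs (d : ℕ) := EuclideanSpace ℝ (Fin d)

/-- The space `ℝⁿ` of the latent vector `Z`. -/
abbrev Lat (n : ℕ) := Fin n → ℝ

/-- `g` is continuously differentiable and a `C¹` diffeomorphism onto its image: a homeomorphism
onto its image whose differential is injective at every point. -/
structure IsDiffeoOntoImage {n d : ℕ} (g : Lat n → Obs d) : Prop where
  contDiff : ContDiff ℝ 1 g
  isEmbedding : Topology.IsEmbedding g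
  injective_fderiv : ∀ z, Function.Injective (fderiv ℝ g z)

/-- The parents of node `i`; an edge `G.Adj j i` points from `j` to `i`. -/
def parents {n : ℕ} (G : Digraph (Fin n)) (i : Fin n) : Finset (Fin n) :=
  open Classical in Finset.univ.filter fun j => G.Adj j i

/-- No node can be reached from itself by a directed path of positive length. -/
def IsDAG {n : ℕ} (G : Digraph (Fin n)) : Prop :=
  ∀ i, ¬ Relation.TransGen G.Adj i i

/-- A continuously differentiable probability density function on `ℝ` with full support. -/
structure IsPositivePDF (q : ℝ → ℝ) : Prop where
  contDiff : ContDiff ℝ 1 q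
  pos : ∀ u, 0 < q u
  lintegral_eq_one : ∫⁻ u, ENNReal.ofReal (q u) = 1

/-- Interventional discrepancy of two densities on `ℝ`. -/
def InterventionalDiscrepancy (p q : ℝ → ℝ) : Prop :=
  ∀ᵐ u : ℝ, deriv (fun v => p v / q v) u ≠ 0

/-! ### The generative model -/

/-- A latent causal model with `n` latent variables, a `d`-dimensional observation, and two sets of
`n` single-node hard interventional environments. -/
structure LatentModel (n d : ℕ) where
  /-- the latent graph -/
  G : Digraph (Fin n)
  isDAG : IsDAG G
  /-- `p i u w` is the conditional density of `Z i` at `u` when the parents of `i` have values `w` -/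
  p : ∀ i : Fin n, ℝ → (parents G i → ℝ) → ℝ
  p_contDiff : ∀ i, ContDiff ℝ 1 fun a : ℝ × (parents G i → ℝ) => p i a.1 a.2
  p_pos : ∀ i u w, 0 < p i u w
  p_lintegral : ∀ i w, ∫⁻ u, ENNReal.ofReal (p i u w) = 1
  /-- every edge is genuine: the mechanism of `i` does depend on each parent of `i` -/
  p_dep : ∀ i, ∀ j : parents G i, ∃ u w w', (∀ k, k ≠ j → w k = w' k) ∧ p i u w ≠ p i u w'
  /-- the hard interventional mechanism of each node in the first set of environments -/
  q : Fin n → ℝ → ℝ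
  q_pdf : ∀ i, IsPositivePDF (q i)
  /-- the hard interventional mechanism of each node in the second set of environments -/
  q' : Fin n → ℝ → ℝ
  q'_pdf : ∀ i, IsPositivePDF (q' i)
  /-- `I m` is the node intervened on in the `m`-th environment of the first set -/
  I : Equiv.Perm (Fin n)
  /-- `I' m` is the node intervened on in the `m`-th environment of the second set -/
  I' : Equiv.Perm (Fin n)
  /-- the transformation generating `X = g(Z)` -/
  g : Lat n → Obs d
  g_diffeo : IsDiffeoOntoImage g

/-- What the learner has access to: the space in which `X` takes its values, and the law of `X` in
the observational environment and in each environment of the two interventional sets. -/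
structure ObservedData (n d : ℕ) where
  range : Set (Obs d)
  obs : Measure (Obs d)
  int : Fin n → Measure (Obs d)
  int' : Fin n → Measure (Obs d)

namespace LatentModel

variable {n d : ℕ} (M : LatentModel n d)

/-- The factor `p_i(z_i | z_{Pa(i)})` as a function of the whole latent vector. -/
def mech (i : Fin n) (z : Lat n) : ℝ := M.p i (z i) fun j => z j

/-- The observational density of `Z`. -/
def density (z : Lat n) : ℝ := ∏ i, M.mech i z

/-- The density of `Z` after a hard intervention replacing the mechanism of node `l` by `q`. -/
def hardDensity (l : Fin n) (q : ℝ → ℝ) (z : Lat n) : ℝ :=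
  q (z l) * ∏ i ∈ Finset.univ.erase l, M.mech i z

/-- The law of `X = g(Z)` when `Z` has density `ρ`. -/
def law (ρ : Lat n → ℝ) : Measure (Obs d) :=
  (volume.withDensity fun z => ENNReal.ofReal (ρ z)).map M.g

/-- The observed data generated by the model. -/
def observed : ObservedData n d where
  range := Set.range M.g
  obs := M.law M.density
  int m := M.law (M.hardDensity (M.I m) (M.q (M.I m)))
  int' m := M.law (M.hardDensity (M.I' m) (M.q' (M.I' m)))

/-- For every node `i`, each pair among `(p_i, q_i, q̃_i)` satisfies interventional discrepancy, for
all values of the parents of `i`. -/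
def PairwiseDiscrepancy : Prop :=
  ∀ i, (∀ w, InterventionalDiscrepancy (fun u => M.p i u w) (M.q i)) ∧
    (∀ w, InterventionalDiscrepancy (fun u => M.p i u w) (M.q' i)) ∧
    InterventionalDiscrepancy (M.q i) (M.q' i)

/-- `π` pairs the environment `m` of the first set with an environment `π m` of the second set that
intervenes on the same node. -/
def IsCorrectCoupling (π : Equiv.Perm (Fin n)) : Prop := ∀ m, M.I' (π m) = M.I m

/-- Perfect DAG recovery: `τ` is a graph isomorphism from `G'` to the latent DAG. -/
def DAGRecovery (G' : Digraph (Fin n)) (τ : Equiv.Perm (Fin n)) : Prop :=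
  ∀ i m, G'.Adj i m ↔ M.G.Adj (τ i) (τ m)

/-- Componentwise latent recovery: `h(X)` is the componentwise diffeomorphic image of `Z`, permuted
by `τ`. -/
def LatentRecovery (h : Obs d → Lat n) (τ : Equiv.Perm (Fin n)) : Prop :=
  ∃ φ : Fin n → (ℝ ≃ₘ^1⟮𝓘(ℝ, ℝ), 𝓘(ℝ, ℝ)⟯ ℝ), ∀ (z : Lat n) (m : Fin n),
    h (M.g z) m = φ (τ m) (z (τ m))

end LatentModel

/-! ### Scores -/

/-- The continuous density of `ν` with respect to Lebesgue measure (zero if there is none).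
It is unique, since Lebesgue measure charges every non-empty open set. -/
def contDensity {n : ℕ} (ν : Measure (Lat n)) : Lat n → ℝ :=
  open Classical in
  if h : ∃ ρ : Lat n → ℝ, Continuous ρ ∧ (∀ z, 0 ≤ ρ z) ∧
      ν = volume.withDensity fun z => ENNReal.ofReal (ρ z)
  then h.choose else 0

/-- The score `∇ log ρ` of the density `ρ` of `ν`. -/
def score {n : ℕ} (ν : Measure (Lat n)) (z : Lat n) (i : Fin n) : ℝ :=
  fderiv ℝ (fun y => Real.log (contDensity ν y)) z (Pi.single i 1)

/-- The score difference `∇ (log ρ₁ - log ρ₂)`. It is `score ν₁ - score ν₂` where both scores exist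
(see `scoreDiff_eq`); under a map that is merely `C¹` the transformed densities need only be
continuous, while the difference of their logarithms remains `C¹`. -/
def scoreDiff {n : ℕ} (ν₁ ν₂ : Measure (Lat n)) (z : Lat n) (i : Fin n) : ℝ :=
  fderiv ℝ (fun y => Real.log (contDensity ν₁ y) - Real.log (contDensity ν₂ y)) z (Pi.single i 1)

theorem scoreDiff_eq {n : ℕ} (ν₁ ν₂ : Measure (Lat n)) (z : Lat n)
    (h₁ : DifferentiableAt ℝ (fun y => Real.log (contDensity ν₁ y)) z)
    (h₂ : DifferentiableAt ℝ (fun y => Real.log (contDensity ν₂ y)) z) (i : Fin n) :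
    scoreDiff ν₁ ν₂ z i = score ν₁ z i - score ν₂ z i := by
  unfold scoreDiff score
  rw [fderiv_fun_sub h₁ h₂]
  rfl

/-! ### The constrained optimisation problem -/

/-- `h` is a valid encoder on `S`: the inverse of a `C¹` diffeomorphism from `ℝⁿ` onto `S`. -/
def IsValidEncoder {n d : ℕ} (S : Set (Obs d)) (h : Obs d → Lat n) : Prop :=
  ∃ r : Lat n → Obs d, IsDiffeoOntoImage r ∧ Set.range r = S ∧ ∀ z, h (r z) = z

/-- `E |s₁(Ẑ; h) - s₂(Ẑ; h)|_i`, where `Ẑ = h(X)`, the scores are those of `Ẑ` when `X` has law `μ₁`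
and `μ₂`, and the expectation is taken when `X` has law `μ₀`. It may be infinite. -/
def scoreChange {n d : ℕ} (μ₀ μ₁ μ₂ : Measure (Obs d)) (h : Obs d → Lat n) (i : Fin n) : ℝ≥0∞ :=
  ∫⁻ z, ‖scoreDiff (μ₁.map h) (μ₂.map h) z i‖ₑ ∂(μ₀.map h)

/-- The matrix `𝟙{A}` of indicators of the nonzero entries of `A`. -/
def nonzeroPattern {n : ℕ} (A : Matrix (Fin n) (Fin n) ℝ≥0∞) : Matrix (Fin n) (Fin n) ℕ :=
  open Classical in Matrix.of fun i m => if A i m ≠ 0 then 1 else 0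

namespace ObservedData

variable {n d : ℕ} (D : ObservedData n d)

/-- Score changes between the observational environment and the first interventional set. -/
def scoreMatrix (h : Obs d → Lat n) : Matrix (Fin n) (Fin n) ℝ≥0∞ :=
  Matrix.of fun i m => scoreChange D.obs D.obs (D.int m) h i

/-- Score changes between the observational environment and the second interventional set. -/
def scoreMatrix' (h : Obs d → Lat n) : Matrix (Fin n) (Fin n) ℝ≥0∞ :=
  Matrix.of fun i m => scoreChange D.obs D.obs (D.int' m) h i

/-- Score changes between the two interventional sets, coupled through `π`. -/
def coupledScoreMatrix (h : Obs d → Lat n) (π : Equiv.Perm (Fin n)) :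
    Matrix (Fin n) (Fin n) ℝ≥0∞ :=
  Matrix.of fun i m => scoreChange D.obs (D.int m) (D.int' (π m)) h i

/-- A candidate solution: an encoder `h`, a decoder `r` and a coupling `π`. -/
structure Candidate (n d : ℕ) where
  h : Obs d → Lat n
  r : Lat n → Obs d
  π : Equiv.Perm (Fin n)

/-- The squared Frobenius distance of the coupled score matrix to the identity, plus `lam` times the
expected reconstruction error. -/
def objective (lam : ℝ) (c : Candidate n d) : ℝ≥0∞ :=
  (∑ i, ∑ m, ((D.coupledScoreMatrix c.h c.π i m - (1 : Matrix (Fin n) (Fin n) ℝ≥0∞) i m) +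
      ((1 : Matrix (Fin n) (Fin n) ℝ≥0∞) i m - D.coupledScoreMatrix c.h c.π i m)) ^ 2) +
    ENNReal.ofReal lam * ∫⁻ x, ‖c.r (c.h x) - x‖ₑ ^ 2 ∂D.obs

/-- The constraints on a candidate. -/
structure IsFeasible (c : Candidate n d) : Prop where
  encoder : IsValidEncoder D.range c.h
  decoder : Measurable c.r
  coupling : nonzeroPattern (D.scoreMatrix c.h) =
    nonzeroPattern (D.scoreMatrix' c.h) * (c.π.permMatrix ℕ)ᵀ
  no_two_cycles : nonzeroPattern (D.scoreMatrix c.h) ⊙ (nonzeroPattern (D.scoreMatrix c.h))ᵀ = 1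

/-- A feasible candidate of least objective value. -/
def IsMinimizer (lam : ℝ) (c : Candidate n d) : Prop :=
  D.IsFeasible c ∧ ∀ c', D.IsFeasible c' → D.objective lam c ≤ D.objective lam c'

/-- The graph estimate built from an encoder: `i` is a parent of `m` if `i ≠ m` and the `i`-th
coordinate of the score changes between the observational environment and environment `m`. -/
def graphEstimate (h : Obs d → Lat n) : Digraph (Fin n) where
  Adj i m := i ≠ m ∧ D.scoreMatrix h i m ≠ 0

end ObservedData

end CRL

end

/-! Write φ = h ∘ g, a C¹ change of coordinates with inverse ψ. In a difference of two scores the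
Jacobian term cancels, so every score change is a partial derivative, in the coordinates ẑ = φ(z),
of a difference of latent log-densities. An intervention alters one factor only, so against the
observational density this difference is log p_l − log q_l, a function of z_l and its parents. By
continuity and positivity, a zero expectation means that the partial derivative vanishes everywhere.

Suppose the objective is zero. The coupled score matrix is then diagonal, so by the chain rule the
z-gradient of the m-th coupled difference is a multiple of the gradient of φ_m. If the coupling is
correct, this difference is log q − log q̃ of the single variable z_{I(m)}, with derivative nonzero
on a dense set, so φ_m depends on z_{I(m)} alone (`isComponentwise_of_isCorrectCoupling`). The zeros
of D(h) then reveal the graph.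

The coupling must be correct (`isCorrectCoupling_of_diagonal`). Otherwise take a miscoupled node a
with no miscoupled child. Only two coordinates s, t of φ can depend on z_a, namely those whose
coupled pair involves an intervention on a. Any function independent of z_a therefore has ẑ_s- and
ẑ_t-derivatives that vanish together. Applied to the log-ratios of the environments t and π(s), this
contradicts the nonzero diagonal, the absence of 2-cycles and the equality of patterns.

Finally the value zero is attained (`exists_isFeasible_objective_eq_zero`): rescaling each latent
coordinate by a suitable diffeomorphism turns the diagonal entries into ones. Hence every minimiser
has value zero. -/

namespace CRL

/-! ### Partial derivatives -/

section PartialDerivatives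

variable {n : ℕ}

/-- The partial derivative of `f` along the `i`-th coordinate. -/
noncomputable def pd (f : Lat n → ℝ) (i : Fin n) (z : Lat n) : ℝ := fderiv ℝ f z (Pi.single i 1)

theorem continuous_pd {f : Lat n → ℝ} (hf : ContDiff ℝ 1 f) (i : Fin n) : Continuous (pd f i) :=
  (hf.continuous_fderiv one_ne_zero).clm_apply continuous_const

theorem hasDerivAt_comp_update {f : Lat n → ℝ} (hf : Differentiable ℝ f) (z : Lat n) (i : Fin n)
    (t : ℝ) :
    HasDerivAt (fun u => f (Function.update z i u)) (pd f i (Function.update z i t)) t :=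
  (hf _).hasFDerivAt.comp_hasDerivAt t (hasDerivAt_update z i t)

theorem pd_eq_deriv {f : Lat n → ℝ} (hf : Differentiable ℝ f) (z : Lat n) (i : Fin n) :
    pd f i z = deriv (fun u => f (Function.update z i u)) (z i) := by
  simpa using (hasDerivAt_comp_update hf z i (z i)).deriv.symm

theorem pd_eq_zero_of_update {f : Lat n → ℝ} (hf : Differentiable ℝ f) {i : Fin n}
    (h : ∀ z t, f (Function.update z i t) = f z) (z : Lat n) : pd f i z = 0 := by
  rw [pd_eq_deriv hf]
  simp [h z]

theorem update_eq_of_pd_eq_zero {f : Lat n → ℝ} (hf : Differentiable ℝ f) {i : Fin n}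
    (h : ∀ z, pd f i z = 0) (z : Lat n) (t : ℝ) : f (Function.update z i t) = f z := by
  have := is_const_of_deriv_eq_zero (f := fun u => f (Function.update z i u))
    (fun u => (hasDerivAt_comp_update hf z i u).differentiableAt)
    (fun u => by rw [(hasDerivAt_comp_update hf z i u).deriv, h]) t (z i)
  simpa using this

theorem pd_sub {f g : Lat n → ℝ} (hf : Differentiable ℝ f) (hg : Differentiable ℝ g) (i : Fin n)
    (z : Lat n) : pd (fun y => f y - g y) i z = pd f i z - pd g i z := by
  unfold pd
  rw [fderiv_fun_sub (hf z) (hg z)]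
  rfl

/-- A function whose partial derivatives in all coordinates but the `l`-th vanish depends on the
`l`-th coordinate only. -/
theorem eq_of_pd_eq_zero {f : Lat n → ℝ} (hf : Differentiable ℝ f) {l : Fin n}
    (h : ∀ j, j ≠ l → ∀ z, pd f j z = 0) {z z' : Lat n} (hz : z l = z' l) : f z = f z' := by
  classical
  -- Replace the coordinates of z by those of z' one at a time; replacing the l-th one changes
  -- nothing.
  have key : ∀ s : Finset (Fin n), f (fun k => if k ∈ s then z' k else z k) = f z := by
    intro s
    induction s using Finset.induction_on with
    | empty => simp
    | insert a s ha ih =>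
      have e : (fun k => if k ∈ insert a s then z' k else z k)
          = Function.update (fun k => if k ∈ s then z' k else z k) a (z' a) := by
        ext k
        by_cases hk : k = a
        · subst hk; simp
        · simp [hk]
      rw [e, ← ih]
      by_cases hal : a = l
      · subst hal
        congr 1
        ext k
        by_cases hk : k = a
        · subst hk; simp [ha, hz]
        · simp [hk]
      · exact update_eq_of_pd_eq_zero hf (h a hal) _ _
  simpa using (key Finset.univ).symm

/-- Interventional discrepancy is an almost-everywhere statement on lines; the continuity arguments
below only need density in ℝⁿ. -/
theorem dense_of_forall_ae_update {f : Lat n → ℝ} {l : Fin n}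
    (h : ∀ z : Lat n, ∀ᵐ u : ℝ, f (Function.update z l u) ≠ 0) : Dense {z | f z ≠ 0} := by
  intro z
  have hd := Measure.dense_of_ae (h z)
  have hc : Continuous fun u : ℝ => Function.update z l u :=
    continuous_const.update l continuous_id
  have := image_closure_subset_closure_image (s := {u | f (Function.update z l u) ≠ 0}) hc
    ⟨z l, hd (z l), rfl⟩
  simp only [Function.update_eq_self] at this
  refine closure_mono ?_ this
  rintro _ ⟨u, hu, rfl⟩
  exact hu

theorem eq_zero_of_dense {X : Type*} [TopologicalSpace X] {f g : X → ℝ} (hf : Continuous f)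
    (hg : Dense {x | g x ≠ 0}) (h : ∀ x, g x * f x = 0) (x : X) : f x = 0 := by
  have : (fun x => f x) = fun _ => 0 := hf.ext_on hg continuous_const
    fun y hy => (mul_eq_zero.1 (h y)).resolve_left hy
  exact congrFun this x

end PartialDerivatives

/-! ### Transition maps between two parametrisations -/

section Transition

variable {n d : ℕ}

/-- `φ` and `ψ` are mutually inverse continuously differentiable maps of `ℝⁿ`. -/
structure IsC1Inverse (φ ψ : Lat n → Lat n) : Prop where
  contDiff : ContDiff ℝ 1 φ
  contDiff_inv : ContDiff ℝ 1 ψ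
  left_inv : ∀ z, ψ (φ z) = z
  right_inv : ∀ y, φ (ψ y) = y

/-- With L a linear left inverse of the differential of r at f z, the map L ∘ r is locally
invertible by the inverse function theorem. Since f is continuous, it equals this local inverse
composed with L ∘ g near z. -/
theorem contDiff_of_comp_eq {r g : Lat n → Obs d} {f : Lat n → Lat n} (hr : IsDiffeoOntoImage r)
    (hg : IsDiffeoOntoImage g) (h : ∀ z, r (f z) = g z) : ContDiff ℝ 1 f := by
  have hfc : Continuous f := by
    rw [hr.isEmbedding.continuous_iff]
    have : r ∘ f = g := funext h
    rw [this]
    exact hg.contDiff.continuous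
  rw [contDiff_iff_contDiffAt]
  intro z
  obtain ⟨L, hL⟩ := LinearMap.exists_leftInverse_of_injective (fderiv ℝ r (f z)).toLinearMap
    (LinearMap.ker_eq_bot.2 (hr.injective_fderiv (f z)))
  let L' : Obs d →L[ℝ] Lat n := LinearMap.toContinuousLinearMap L
  have hd : HasFDerivAt (fun y => L' (r y))
      ((ContinuousLinearEquiv.refl ℝ (Lat n) : Lat n ≃L[ℝ] Lat n) : Lat n →L[ℝ] Lat n) (f z) := by
    have h1 := L'.hasFDerivAt.comp (f z)
      (hr.contDiff.differentiable one_ne_zero (f z)).hasFDerivAt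
    have e : L'.comp (fderiv ℝ r (f z)) =
        ((ContinuousLinearEquiv.refl ℝ (Lat n) : Lat n ≃L[ℝ] Lat n) : Lat n →L[ℝ] Lat n) :=
      ContinuousLinearMap.ext fun v => LinearMap.congr_fun hL v
    rw [e] at h1
    exact h1
  have hcd : ContDiffAt ℝ 1 (fun y => L' (r y)) (f z) :=
    (L'.contDiff.comp hr.contDiff).contDiffAt
  have hinv := hcd.to_localInverse hd one_ne_zero
  have hs := hcd.hasStrictFDerivAt' hd one_ne_zero
  have hev : ∀ᶠ y in nhds (f z), hcd.localInverse hd one_ne_zero (L' (r y)) = y :=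
    hs.eventually_left_inverse
  have hev' := hfc.continuousAt.eventually hev
  have hcomp : ContDiffAt ℝ 1 (fun x => hcd.localInverse hd one_ne_zero (L' (g x))) z := by
    have hLg : ContDiffAt ℝ 1 (fun x => L' (g x)) z := (L'.contDiff.comp hg.contDiff).contDiffAt
    refine ContDiffAt.comp z ?_ hLg
    rw [← h z]
    exact hinv
  refine hcomp.congr_of_eventuallyEq ?_
  filter_upwards [hev'] with x hx
  rw [h x] at hx
  exact hx.symm

theorem IsValidEncoder.exists_isC1Inverse {g : Lat n → Obs d} {h : Obs d → Lat n}
    (hg : IsDiffeoOntoImage g) (hh : IsValidEncoder (Set.range g) h) :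
    ∃ ψ, IsC1Inverse (fun z => h (g z)) ψ := by
  obtain ⟨r, hr, hrange, hrh⟩ := hh
  have h1 : ∀ z, r (h (g z)) = g z := by
    intro z
    obtain ⟨y, hy⟩ : g z ∈ Set.range r := hrange ▸ Set.mem_range_self z
    rw [← hy, hrh]
  have h2 : ∀ y, ∃ z, g z = r y := fun y => by
    have : r y ∈ Set.range g := hrange ▸ Set.mem_range_self y
    exact this
  choose ψ hψ using h2
  refine ⟨ψ, contDiff_of_comp_eq hr hg h1, contDiff_of_comp_eq hg hr hψ, fun z => ?_, fun y => ?_⟩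
  · apply hg.isEmbedding.injective
    rw [hψ, h1]
  · simp only [hψ, hrh]

variable {φ ψ : Lat n → Lat n}

theorem IsC1Inverse.symm (H : IsC1Inverse φ ψ) : IsC1Inverse ψ φ :=
  ⟨H.contDiff_inv, H.contDiff, H.right_inv, H.left_inv⟩

theorem IsC1Inverse.fderiv_comp (H : IsC1Inverse φ ψ) (z : Lat n) :
    (fderiv ℝ ψ (φ z)).comp (fderiv ℝ φ z) = ContinuousLinearMap.id ℝ (Lat n) := by
  have h1 := ((H.contDiff_inv.differentiable one_ne_zero (φ z)).hasFDerivAt).comp z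
    (H.contDiff.differentiable one_ne_zero z).hasFDerivAt
  have h2 : HasFDerivAt (ψ ∘ φ) (ContinuousLinearMap.id ℝ (Lat n)) z := by
    have : ψ ∘ φ = id := funext H.left_inv
    rw [this]
    exact hasFDerivAt_id z
  exact h1.unique h2

theorem IsC1Inverse.contDiff_coord (H : IsC1Inverse φ ψ) (m : Fin n) :
    ContDiff ℝ 1 fun z => φ z m :=
  contDiff_pi.1 H.contDiff m

theorem IsC1Inverse.differentiable_coord (H : IsC1Inverse φ ψ) (m : Fin n) :
    Differentiable ℝ fun z => φ z m :=
  (H.contDiff_coord m).differentiable one_ne_zero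

theorem IsC1Inverse.fderiv_apply (H : IsC1Inverse φ ψ) (z v : Lat n) (m : Fin n) :
    fderiv ℝ φ z v m = fderiv ℝ (fun y => φ y m) z v := by
  have := (hasFDerivAt_pi'.1 (H.contDiff.differentiable one_ne_zero z).hasFDerivAt m).fderiv
  rw [this]
  rfl

/-- The chain rule for the change of coordinates `φ`. -/
theorem IsC1Inverse.pd_eq_sum (H : IsC1Inverse φ ψ) {L : Lat n → ℝ} (hL : Differentiable ℝ L)
    (j : Fin n) (z : Lat n) :
    pd L j z = ∑ m, pd (fun y => φ y m) j z * pd (fun y => L (ψ y)) m (φ z) := by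
  have hLψ : Differentiable ℝ fun y => L (ψ y) :=
    hL.comp (H.contDiff_inv.differentiable one_ne_zero)
  have h1 := (hLψ (φ z)).hasFDerivAt.comp z (H.contDiff.differentiable one_ne_zero z).hasFDerivAt
  have h2 : ((fun y => L (ψ y)) ∘ φ) = L := by
    ext y
    simp [H.left_inv]
  rw [h2] at h1
  have h3 : pd L j z = fderiv ℝ (fun y => L (ψ y)) (φ z) (fderiv ℝ φ z (Pi.single j 1)) := by
    unfold pd
    rw [h1.fderiv]
    rfl
  rw [h3, pi_eq_sum_univ' (fderiv ℝ φ z (Pi.single j 1)), map_sum]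
  refine Finset.sum_congr rfl fun m _ => ?_
  rw [map_smul, H.fderiv_apply, smul_eq_mul]
  rfl

/-- Every coordinate direction moves some coordinate of `φ`. -/
theorem IsC1Inverse.exists_pd_ne_zero (H : IsC1Inverse φ ψ) (j : Fin n) (z : Lat n) :
    ∃ m, pd (fun y => φ y m) j z ≠ 0 := by
  by_contra! h
  have h0 : fderiv ℝ φ z (Pi.single j 1) = 0 := by
    ext m
    rw [H.fderiv_apply]
    exact h m
  have h1 := congrArg (fun A : Lat n →L[ℝ] Lat n => A (Pi.single j 1) j) (H.fderiv_comp z)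
  simp [h0] at h1

end Transition

/-! ### Change of variables and score differences -/

section Scores

variable {n d : ℕ} {φ ψ : Lat n → Lat n}

/-- Densities of the same measure agree almost everywhere, hence everywhere when continuous; this
pins down the choice made in `contDensity`. -/
theorem contDensity_eq {ν : Measure (Lat n)} {ρ : Lat n → ℝ} (hρ : Continuous ρ)
    (h0 : ∀ z, 0 ≤ ρ z) (hν : ν = volume.withDensity fun z => ENNReal.ofReal (ρ z)) :
    contDensity ν = ρ := by
  have hex : ∃ ρ : Lat n → ℝ, Continuous ρ ∧ (∀ z, 0 ≤ ρ z) ∧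
      ν = volume.withDensity fun z => ENNReal.ofReal (ρ z) := ⟨ρ, hρ, h0, hν⟩
  have hc : contDensity ν = hex.choose := by
    unfold contDensity
    rw [dif_pos hex]
  obtain ⟨c1, c2, c3⟩ := hex.choose_spec
  rw [hc]
  set ρ' := hex.choose
  have hae : (fun z => ENNReal.ofReal (ρ' z)) =ᵐ[volume] fun z => ENNReal.ofReal (ρ z) := by
    rw [← withDensity_eq_iff_of_sigmaFinite
      (c1.measurable.ennreal_ofReal).aemeasurable
      (hρ.measurable.ennreal_ofReal).aemeasurable]
    rw [← c3, ← hν]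
  refine (Continuous.ae_eq_iff_eq volume c1 hρ).1 ?_
  filter_upwards [hae] with z hz
  exact (ENNReal.ofReal_eq_ofReal_iff (c2 z) (h0 z)).1 hz

theorem IsC1Inverse.measurableEmbedding (H : IsC1Inverse φ ψ) : MeasurableEmbedding φ :=
  H.contDiff.continuous.measurableEmbedding (Function.LeftInverse.injective H.left_inv)

theorem IsC1Inverse.map_withDensity (H : IsC1Inverse φ ψ) {ρ : Lat n → ℝ} :
    (volume.withDensity fun z => ENNReal.ofReal (ρ z)).map φ =
      volume.withDensity fun y => ENNReal.ofReal (|(fderiv ℝ ψ y).det| * ρ (ψ y)) := by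
  ext A hA
  rw [H.measurableEmbedding.map_apply, withDensity_apply _ (H.contDiff.continuous.measurable hA),
    withDensity_apply _ hA]
  have himg : φ ⁻¹' A = ψ '' A := by
    ext z
    constructor
    · intro hz
      exact ⟨φ z, hz, H.left_inv z⟩
    · rintro ⟨y, hy, rfl⟩
      simpa [H.right_inv] using hy
  rw [himg, lintegral_image_eq_lintegral_abs_det_fderiv_mul volume hA (f' := fderiv ℝ ψ)
    (fun y _ => (H.contDiff_inv.differentiable one_ne_zero y).hasFDerivAt.hasFDerivWithinAt)
    (Function.LeftInverse.injective H.right_inv).injOn]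
  refine lintegral_congr fun y => ?_
  rw [ENNReal.ofReal_mul (abs_nonneg _)]

theorem IsC1Inverse.det_ne_zero (H : IsC1Inverse φ ψ) (y : Lat n) : (fderiv ℝ ψ y).det ≠ 0 := by
  have h := H.symm.fderiv_comp y
  have h2 : ((fderiv ℝ φ (ψ y)).comp (fderiv ℝ ψ y)).det = 1 := by
    rw [h]
    simp [ContinuousLinearMap.det]
  have h3 : (fderiv ℝ φ (ψ y)).det * (fderiv ℝ ψ y).det = 1 := by
    rw [← h2]
    exact (LinearMap.det_comp _ _).symm
  exact right_ne_zero_of_mul_eq_one h3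

/-- In the difference of two scores the Jacobian of the change of coordinates cancels. -/
theorem IsC1Inverse.scoreDiff_map (H : IsC1Inverse φ ψ) {ρ₁ ρ₂ : Lat n → ℝ}
    (h₁ : Continuous ρ₁) (h₂ : Continuous ρ₂) (p₁ : ∀ z, 0 < ρ₁ z) (p₂ : ∀ z, 0 < ρ₂ z)
    (y : Lat n) (i : Fin n) :
    scoreDiff ((volume.withDensity fun z => ENNReal.ofReal (ρ₁ z)).map φ)
      ((volume.withDensity fun z => ENNReal.ofReal (ρ₂ z)).map φ) y i =
      pd (fun y => Real.log (ρ₁ (ψ y)) - Real.log (ρ₂ (ψ y))) i y := by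
  have hdet : Continuous fun y => |(fderiv ℝ ψ y).det| :=
    (ContinuousLinearMap.continuous_det.comp (H.contDiff_inv.continuous_fderiv one_ne_zero)).abs
  have key : ∀ ρ : Lat n → ℝ, Continuous ρ → (∀ z, 0 < ρ z) →
      contDensity ((volume.withDensity fun z => ENNReal.ofReal (ρ z)).map φ) =
        fun y => |(fderiv ℝ ψ y).det| * ρ (ψ y) := fun ρ hρ p =>
    contDensity_eq (hdet.mul (hρ.comp H.contDiff_inv.continuous))
      (fun z => mul_nonneg (abs_nonneg _) (p _).le) H.map_withDensity
  unfold scoreDiff pd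
  rw [key ρ₁ h₁ p₁, key ρ₂ h₂ p₂]
  congr 2
  ext y
  have hd : |(fderiv ℝ ψ y).det| ≠ 0 := abs_ne_zero.2 (H.det_ne_zero y)
  rw [Real.log_mul hd (p₁ _).ne', Real.log_mul hd (p₂ _).ne']
  ring

theorem map_law (M : LatentModel n d) {h : Obs d → Lat n}
    (H : IsC1Inverse (fun z => h (M.g z)) ψ) (ρ : Lat n → ℝ) :
    (M.law ρ).map h =
      (volume.withDensity fun z => ENNReal.ofReal (ρ z)).map fun z => h (M.g z) := by
  have hemb : MeasurableEmbedding M.g :=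
    M.g_diffeo.contDiff.continuous.measurableEmbedding M.g_diffeo.isEmbedding.injective
  unfold LatentModel.law
  -- `h` need not be measurable off the range of `g`; the law lives on that range, where `h ∘ g` is
  -- continuous.
  refine AEMeasurable.map_map_of_aemeasurable ?_ hemb.measurable.aemeasurable
  rw [hemb.aemeasurable_map_iff]
  exact H.contDiff.continuous.measurable.aemeasurable

/-- Score changes in latent coordinates. -/
theorem scoreChange_law (M : LatentModel n d) {h : Obs d → Lat n}
    (H : IsC1Inverse (fun z => h (M.g z)) ψ) {ρ₀ ρ₁ ρ₂ : Lat n → ℝ} (h₀ : Continuous ρ₀)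
    (h₁ : Continuous ρ₁) (h₂ : Continuous ρ₂) (p₁ : ∀ z, 0 < ρ₁ z) (p₂ : ∀ z, 0 < ρ₂ z)
    (i : Fin n) :
    scoreChange (M.law ρ₀) (M.law ρ₁) (M.law ρ₂) h i =
      ∫⁻ z, ENNReal.ofReal (ρ₀ z) *
        ‖pd (fun y => Real.log (ρ₁ (ψ y)) - Real.log (ρ₂ (ψ y))) i (h (M.g z))‖ₑ := by
  unfold scoreChange
  rw [map_law M H, map_law M H, map_law M H, H.measurableEmbedding.lintegral_map,
    lintegral_withDensity_eq_lintegral_mul_non_measurable _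
      (h₀.measurable.ennreal_ofReal) (by simp)]
  refine lintegral_congr fun z => ?_
  simp only [Pi.mul_apply]
  rw [H.scoreDiff_map h₁ h₂ p₁ p₂]

/-- The weight `ρ₀` is positive and the derivative continuous, so a zero integral forces vanishing
at every φ(z), that is, everywhere. -/
theorem scoreChange_law_eq_zero_iff (M : LatentModel n d) {h : Obs d → Lat n}
    (H : IsC1Inverse (fun z => h (M.g z)) ψ) {ρ₀ ρ₁ ρ₂ L : Lat n → ℝ} (h₀ : Continuous ρ₀)
    (h₁ : Continuous ρ₁) (h₂ : Continuous ρ₂) (p₀ : ∀ z, 0 < ρ₀ z) (p₁ : ∀ z, 0 < ρ₁ z)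
    (p₂ : ∀ z, 0 < ρ₂ z) (hL : ContDiff ℝ 1 L)
    (hLe : ∀ z, Real.log (ρ₁ z) - Real.log (ρ₂ z) = L z) (i : Fin n) :
    scoreChange (M.law ρ₀) (M.law ρ₁) (M.law ρ₂) h i = 0 ↔
      ∀ y, pd (fun y => L (ψ y)) i y = 0 := by
  rw [scoreChange_law M H h₀ h₁ h₂ p₁ p₂]
  simp only [hLe]
  have hc : Continuous fun z => pd (fun y => L (ψ y)) i (h (M.g z)) :=
    (continuous_pd (hL.comp H.contDiff_inv) i).comp H.contDiff.continuous
  have hm : Measurable fun z =>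
      ENNReal.ofReal (ρ₀ z) * ‖pd (fun y => L (ψ y)) i (h (M.g z))‖ₑ :=
    h₀.measurable.ennreal_ofReal.mul hc.measurable.enorm
  rw [lintegral_eq_zero_iff hm]
  constructor
  · intro hz y
    have : (fun z => pd (fun y => L (ψ y)) i (h (M.g z))) =ᵐ[volume] fun _ => 0 := by
      filter_upwards [hz] with z hz
      have hz' : ENNReal.ofReal (ρ₀ z) * ‖pd (fun y => L (ψ y)) i (h (M.g z))‖ₑ = 0 := hz
      rcases mul_eq_zero.1 hz' with h' | h'
      · exact absurd (ENNReal.ofReal_eq_zero.1 h') (not_le.2 (p₀ z))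
      · exact enorm_eq_zero.1 h'
    have := congrFun ((Continuous.ae_eq_iff_eq volume hc continuous_const).1 this) (ψ y)
    have hr : h (M.g (ψ y)) = y := H.right_inv y
    simpa [hr] using this
  · intro hy
    refine Filter.Eventually.of_forall fun z => ?_
    simp [hy]

end Scores

/-! ### Regularity of the latent model -/

namespace LatentModel

variable {n d : ℕ} (M : LatentModel n d)

theorem mem_parents {G : Digraph (Fin n)} {i j : Fin n} : j ∈ parents G i ↔ G.Adj j i := by
  simp [parents]

theorem not_adj_self (i : Fin n) : ¬ M.G.Adj i i := fun h => M.isDAG i (.single h)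

theorem not_adj_symm {i j : Fin n} (h : M.G.Adj i j) : ¬ M.G.Adj j i := fun h' =>
  M.isDAG i (.tail (.single h) h')

/-- A non-empty set of nodes contains a node with no child in the set. -/
theorem exists_forall_not_adj {A : Set (Fin n)} (hA : A.Nonempty) :
    ∃ a ∈ A, ∀ i ∈ A, ¬ M.G.Adj a i := by
  have : Std.Irrefl (Relation.TransGen fun a b => M.G.Adj b a) := ⟨fun a ha =>
    M.isDAG a (Relation.transGen_swap.1 ha)⟩
  have wf : WellFounded (Relation.TransGen fun a b => M.G.Adj b a) :=
    Finite.wellFounded_of_trans_of_irrefl _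
  obtain ⟨a, haA, hmin⟩ := wf.has_min A hA
  exact ⟨a, haA, fun i hi h => hmin i hi (.single h)⟩

theorem mech_pos (i : Fin n) (z : Lat n) : 0 < M.mech i z := M.p_pos _ _ _

theorem contDiff_mech (i : Fin n) : ContDiff ℝ 1 (M.mech i) := by
  have : ContDiff ℝ 1 fun z : Lat n => (z i, fun j : parents M.G i => z j) :=
    (contDiff_apply ℝ ℝ i).prodMk (contDiff_pi.2 fun j => contDiff_apply ℝ ℝ (j : Fin n))
  exact (M.p_contDiff i).comp this

theorem density_pos (z : Lat n) : 0 < M.density z := Finset.prod_pos fun i _ => M.mech_pos i z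

theorem continuous_density : Continuous M.density :=
  continuous_finsetProd _ fun i _ => (M.contDiff_mech i).continuous

variable {q q' : ℝ → ℝ}

theorem hardDensity_pos (hq : IsPositivePDF q) (l : Fin n) (z : Lat n) :
    0 < M.hardDensity l q z :=
  mul_pos (hq.pos _) (Finset.prod_pos fun i _ => M.mech_pos i z)

theorem continuous_hardDensity (hq : IsPositivePDF q) (l : Fin n) :
    Continuous (M.hardDensity l q) :=
  (hq.contDiff.continuous.comp (continuous_apply l)).mul
    (continuous_finsetProd _ fun i _ => (M.contDiff_mech i).continuous)

/-- The log-ratio of the observational and the interventional mechanism of node `l`. -/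
noncomputable def logRatio (l : Fin n) (q : ℝ → ℝ) (z : Lat n) : ℝ :=
  Real.log (M.mech l z) - Real.log (q (z l))

theorem contDiff_logRatio (hq : IsPositivePDF q) (l : Fin n) : ContDiff ℝ 1 (M.logRatio l q) :=
  ((M.contDiff_mech l).log fun z => (M.mech_pos l z).ne').sub
    ((hq.contDiff.comp (contDiff_apply ℝ ℝ l)).log fun z => (hq.pos (z l)).ne')

theorem log_density_sub (hq : IsPositivePDF q) (l : Fin n) (z : Lat n) :
    Real.log (M.density z) - Real.log (M.hardDensity l q z) = M.logRatio l q z := by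
  have hP : (∏ i ∈ Finset.univ.erase l, M.mech i z) ≠ 0 :=
    (Finset.prod_pos fun i _ => M.mech_pos i z).ne'
  unfold density hardDensity logRatio
  rw [← Finset.mul_prod_erase Finset.univ (fun i => M.mech i z) (Finset.mem_univ l),
    Real.log_mul (M.mech_pos l z).ne' hP, Real.log_mul (hq.pos _).ne' hP]
  ring

theorem log_hardDensity_sub (hq : IsPositivePDF q) (hq' : IsPositivePDF q') (l l' : Fin n)
    (z : Lat n) :
    Real.log (M.hardDensity l q z) - Real.log (M.hardDensity l' q' z) =
      M.logRatio l' q' z - M.logRatio l q z := by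
  rw [← M.log_density_sub hq, ← M.log_density_sub hq']
  ring

theorem logRatio_update_of_ne {j l : Fin n} (hjl : j ≠ l) (hj : ¬ M.G.Adj j l) (z : Lat n)
    (t : ℝ) : M.logRatio l q (Function.update z j t) = M.logRatio l q z := by
  have h : (fun k : parents M.G l => Function.update z j t k) = fun k : parents M.G l => z k := by
    ext k
    refine Function.update_of_ne ?_ _ _
    rintro rfl
    exact hj (mem_parents.1 k.2)
  unfold logRatio mech
  rw [h, Function.update_of_ne hjl.symm]

theorem pd_logRatio_of_ne (hq : IsPositivePDF q) {j l : Fin n} (hjl : j ≠ l)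
    (hj : ¬ M.G.Adj j l) (z : Lat n) : pd (M.logRatio l q) j z = 0 :=
  pd_eq_zero_of_update ((M.contDiff_logRatio hq l).differentiable one_ne_zero)
    (M.logRatio_update_of_ne hjl hj) z

/-- The ratio is the exponential of the log-difference, so a critical point of the latter is one of
the former. -/
theorem _root_.CRL.InterventionalDiscrepancy.ae_deriv_log {a b : ℝ → ℝ}
    (h : InterventionalDiscrepancy a b) (ha : Differentiable ℝ a) (hb : Differentiable ℝ b)
    (pa : ∀ u, 0 < a u) (pb : ∀ u, 0 < b u) :
    ∀ᵐ u : ℝ, deriv (fun v => Real.log (a v) - Real.log (b v)) u ≠ 0 := by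
  filter_upwards [h] with u hu h0
  apply hu
  have e : (fun v => a v / b v) = fun v => Real.exp (Real.log (a v) - Real.log (b v)) := by
    ext v
    rw [Real.exp_sub, Real.exp_log (pa v), Real.exp_log (pb v)]
  have hd : DifferentiableAt ℝ (fun v => Real.log (a v) - Real.log (b v)) u :=
    ((ha u).log (pa u).ne').sub ((hb u).log (pb u).ne')
  rw [e, hd.hasDerivAt.exp.deriv, h0, mul_zero]

theorem differentiable_p (l : Fin n) (w : parents M.G l → ℝ) :
    Differentiable ℝ fun u => M.p l u w := by
  have : Differentiable ℝ fun u : ℝ => (u, w) :=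
    differentiable_id.prodMk (differentiable_const w)
  exact ((M.p_contDiff l).differentiable one_ne_zero).comp this

theorem restrict_update_self (l : Fin n) (z : Lat n) (u : ℝ) :
    (fun k : parents M.G l => Function.update z l u k) = fun k : parents M.G l => z k := by
  ext k
  refine Function.update_of_ne ?_ _ _
  intro h
  have hk := mem_parents.1 k.2
  rw [h] at hk
  exact M.not_adj_self l hk

/-- Along a line in direction l the parents of l stay fixed, so the one-dimensional discrepancy
applies on each such line. -/
theorem dense_pd_logRatio_self (hq : IsPositivePDF q) (l : Fin n)
    (h : ∀ w, InterventionalDiscrepancy (fun u => M.p l u w) q) :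
    Dense {z | pd (M.logRatio l q) l z ≠ 0} := by
  refine dense_of_forall_ae_update (l := l) fun z => ?_
  have hL := (M.contDiff_logRatio hq l).differentiable one_ne_zero
  filter_upwards [(h fun k => z k).ae_deriv_log (M.differentiable_p l _)
    (hq.contDiff.differentiable one_ne_zero) (fun u => M.p_pos l u _) hq.pos] with u hu
  rw [← (hasDerivAt_comp_update hL z l u).deriv]
  have e : (fun v => M.logRatio l q (Function.update z l v)) =
      fun v => Real.log (M.p l v fun k => z k) - Real.log (q v) := by
    ext v
    unfold logRatio mech
    rw [M.restrict_update_self l z v, Function.update_self]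
  rw [e]
  exact hu

/-- The hard mechanism does not see z_j, so a log-ratio independent of z_j would make p_l
independent of this parent, against `p_dep`. -/
theorem exists_pd_logRatio_ne_zero (hq : IsPositivePDF q) {j l : Fin n} (hj : M.G.Adj j l) :
    ∃ z, pd (M.logRatio l q) j z ≠ 0 := by
  classical
  obtain ⟨u, w, w', hw, hne⟩ := M.p_dep l ⟨j, mem_parents.2 hj⟩
  by_contra! h
  apply hne
  have hlj : l ≠ j := by
    rintro rfl
    exact M.not_adj_self l hj
  -- Extend the parent values to a latent vector; l is not its own parent, so z l takes the filler
  -- value u.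
  let z : Lat n := fun k => if hk : k ∈ parents M.G l then w ⟨k, hk⟩ else u
  have hz := update_eq_of_pd_eq_zero ((M.contDiff_logRatio hq l).differentiable one_ne_zero) h z
    (w' ⟨j, mem_parents.2 hj⟩)
  have hzl : z l = u := by
    simp [z, mem_parents, M.not_adj_self l]
  have e1 : (fun k : parents M.G l => z k) = w := by
    ext k
    simp [z]
  have e2 : (fun k : parents M.G l => Function.update z j (w' ⟨j, mem_parents.2 hj⟩) k) = w' := by
    ext k
    by_cases hk : k = ⟨j, mem_parents.2 hj⟩
    · subst hk
      simp
    · have hk' : (k : Fin n) ≠ j := fun h => hk (Subtype.ext h)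
      rw [Function.update_of_ne hk', ← hw k hk, ← e1]
  unfold logRatio mech at hz
  rw [e1, e2, Function.update_of_ne hlj, hzl] at hz
  exact (Real.log_injOn_pos (M.p_pos _ _ _) (M.p_pos _ _ _) (sub_left_injective hz)).symm

/-! ### The observational density has total mass one -/

-- Integrate out a node of A without children in A: only its own factor involves its variable and
-- integrates to one, and the rest of A is still closed under parents.
open Classical in
theorem lmarginal_prod_mech (A : Finset (Fin n)) (hA : ∀ i ∈ A, ∀ j, M.G.Adj j i → j ∈ A) :
    (∫⋯∫⁻_A, (fun z => ∏ i ∈ A, ENNReal.ofReal (M.mech i z)) ∂fun _ => (volume : Measure ℝ)) =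
      fun _ => 1 := by
  induction hk : A.card generalizing A with
  | zero =>
    rw [Finset.card_eq_zero] at hk
    subst hk
    simp [lmarginal_empty]
  | succ k ih =>
    have hmeas : ∀ i, Measurable fun z => ENNReal.ofReal (M.mech i z) := fun i =>
      (M.contDiff_mech i).continuous.measurable.ennreal_ofReal
    obtain ⟨a, haA', hchild⟩ : ∃ a ∈ A, ∀ i ∈ A, ¬ M.G.Adj a i :=
      M.exists_forall_not_adj (A := A) (Finset.card_pos.1 (by omega))
    rw [lmarginal_erase' _ (Finset.measurable_prod _ fun i _ => hmeas i) haA']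
    have e : (fun x : Lat n => ∫⁻ t : ℝ, ∏ i ∈ A,
        ENNReal.ofReal (M.mech i (Function.update x a t))) =
        fun x => ∏ i ∈ A.erase a, ENNReal.ofReal (M.mech i x) := by
      ext x
      have e1 : ∀ t : ℝ, ∏ i ∈ A, ENNReal.ofReal (M.mech i (Function.update x a t)) =
          (∏ i ∈ A.erase a, ENNReal.ofReal (M.mech i x)) *
            ENNReal.ofReal (M.p a t fun k => x k) := by
        intro t
        rw [← Finset.prod_erase_mul _ _ haA']
        congr 1
        · refine Finset.prod_congr rfl fun i hi => ?_
          have hia := Finset.ne_of_mem_erase hi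
          unfold mech
          rw [Function.update_of_ne hia]
          congr 2
          ext k
          refine Function.update_of_ne ?_ _ _
          intro h
          exact hchild i (Finset.mem_of_mem_erase hi) (h ▸ mem_parents.1 k.2)
        · unfold mech
          rw [M.restrict_update_self a x t, Function.update_self]
      simp only [e1]
      rw [lintegral_const_mul' _ _ (ENNReal.prod_ne_top fun i _ => ENNReal.ofReal_ne_top),
        M.p_lintegral, mul_one]
    rw [e]
    refine ih (A.erase a) (fun i hi j hj => ?_) (by rw [Finset.card_erase_of_mem haA']; omega)
    refine Finset.mem_erase.2 ⟨?_, hA i (Finset.mem_of_mem_erase hi) j hj⟩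
    rintro rfl
    exact hchild i (Finset.mem_of_mem_erase hi) hj

theorem lintegral_density : ∫⁻ z, ENNReal.ofReal (M.density z) = 1 := by
  classical
  have h := M.lmarginal_prod_mech Finset.univ fun _ _ j _ => Finset.mem_univ j
  rw [lmarginal_univ] at h
  have h0 := congrFun h 0
  rw [← h0]
  refine lintegral_congr fun z => ?_
  exact ENNReal.ofReal_prod_of_nonneg fun i _ => (M.mech_pos i z).le

end LatentModel

/-! ### Constraints in terms of vanishing patterns -/

section Patterns

variable {n d : ℕ}

theorem nonzeroPattern_eq_mul_permMatrix_iff (A B : Matrix (Fin n) (Fin n) ℝ≥0∞)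
    (π : Equiv.Perm (Fin n)) :
    nonzeroPattern A = nonzeroPattern B * (π.permMatrix ℕ)ᵀ ↔
      ∀ i m, A i m = 0 ↔ B i (π m) = 0 := by
  have key : ∀ i m, (nonzeroPattern B * (π.permMatrix ℕ)ᵀ) i m = nonzeroPattern B i (π m) := by
    intro i m
    simp [Matrix.mul_apply, Equiv.Perm.permMatrix, PEquiv.toMatrix_apply, Equiv.toPEquiv_apply,
      Equiv.symm_apply_eq]
  rw [← Matrix.ext_iff]
  refine forall_congr' fun i => forall_congr' fun m => ?_
  rw [key]
  by_cases h1 : A i m = 0 <;> by_cases h2 : B i (π m) = 0 <;> simp [nonzeroPattern, h1, h2]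

theorem nonzeroPattern_hadamard_transpose_eq_one_iff (A : Matrix (Fin n) (Fin n) ℝ≥0∞) :
    nonzeroPattern A ⊙ (nonzeroPattern A)ᵀ = 1 ↔
      (∀ m, A m m ≠ 0) ∧ ∀ i m, i ≠ m → A i m = 0 ∨ A m i = 0 := by
  rw [← Matrix.ext_iff]
  constructor
  · intro h
    refine ⟨fun m hm => ?_, fun i m him => ?_⟩
    · have := h m m
      simp [nonzeroPattern, hm] at this
    · have := h i m
      by_contra! hc
      simp [nonzeroPattern, hc.1, hc.2, him] at this
  · rintro ⟨h1, h2⟩ i m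
    by_cases him : i = m
    · subst him
      simp [nonzeroPattern, h1 i]
    · rcases h2 i m him with h | h <;> simp [nonzeroPattern, h, him]

theorem ObservedData.objective_eq_zero_iff (D : ObservedData n d) (lam : ℝ)
    (c : ObservedData.Candidate n d) :
    D.objective lam c = 0 ↔ D.coupledScoreMatrix c.h c.π = 1 ∧
      ENNReal.ofReal lam * ∫⁻ x, ‖c.r (c.h x) - x‖ₑ ^ 2 ∂D.obs = 0 := by
  unfold ObservedData.objective
  rw [add_eq_zero]
  refine and_congr_left fun _ => ?_
  simp only [Finset.sum_eq_zero_iff, Finset.mem_univ, true_imp_iff]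
  rw [← Matrix.ext_iff]
  refine forall_congr' fun i => forall_congr' fun m => ?_
  -- With truncated subtraction, (a − b) + (b − a) is the distance of a and b; it vanishes iff both
  -- inequalities hold.
  rw [pow_eq_zero_iff two_ne_zero, add_eq_zero, tsub_eq_zero_iff_le, tsub_eq_zero_iff_le]
  exact le_antisymm_iff.symm

end Patterns

/-! ### Score changes of the latent model -/

namespace LatentModel

variable {n d : ℕ} (M : LatentModel n d) {h : Obs d → Lat n} {ψ : Lat n → Lat n}

/-- The log-ratio for the node intervened on in environment `m` of the first set. -/
noncomputable abbrev logRatioInt (m : Fin n) : Lat n → ℝ := M.logRatio (M.I m) (M.q (M.I m))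

/-- The log-ratio for the node intervened on in environment `m` of the second set. -/
noncomputable abbrev logRatioInt' (m : Fin n) : Lat n → ℝ := M.logRatio (M.I' m) (M.q' (M.I' m))

theorem scoreMatrix_eq_zero_iff (H : IsC1Inverse (fun z => h (M.g z)) ψ) (i m : Fin n) :
    M.observed.scoreMatrix h i m = 0 ↔ ∀ y, pd (fun y => M.logRatioInt m (ψ y)) i y = 0 :=
  scoreChange_law_eq_zero_iff M H M.continuous_density M.continuous_density
    (M.continuous_hardDensity (M.q_pdf _) _) M.density_pos M.density_pos
    (M.hardDensity_pos (M.q_pdf _) _) (M.contDiff_logRatio (M.q_pdf _) _)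
    (M.log_density_sub (M.q_pdf _) _) i

theorem scoreMatrix'_eq_zero_iff (H : IsC1Inverse (fun z => h (M.g z)) ψ) (i m : Fin n) :
    M.observed.scoreMatrix' h i m = 0 ↔ ∀ y, pd (fun y => M.logRatioInt' m (ψ y)) i y = 0 :=
  scoreChange_law_eq_zero_iff M H M.continuous_density M.continuous_density
    (M.continuous_hardDensity (M.q'_pdf _) _) M.density_pos M.density_pos
    (M.hardDensity_pos (M.q'_pdf _) _) (M.contDiff_logRatio (M.q'_pdf _) _)
    (M.log_density_sub (M.q'_pdf _) _) i

theorem coupledScoreMatrix_eq_zero_iff (H : IsC1Inverse (fun z => h (M.g z)) ψ)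
    (π : Equiv.Perm (Fin n)) (i m : Fin n) :
    M.observed.coupledScoreMatrix h π i m = 0 ↔
      ∀ y, pd (fun y => M.logRatioInt' (π m) (ψ y) - M.logRatioInt m (ψ y)) i y = 0 :=
  scoreChange_law_eq_zero_iff (L := fun z => M.logRatioInt' (π m) z - M.logRatioInt m z) M H
    M.continuous_density (M.continuous_hardDensity (M.q_pdf _) _)
    (M.continuous_hardDensity (M.q'_pdf _) _) M.density_pos (M.hardDensity_pos (M.q_pdf _) _)
    (M.hardDensity_pos (M.q'_pdf _) _)
    ((M.contDiff_logRatio (M.q'_pdf _) _).sub (M.contDiff_logRatio (M.q_pdf _) _))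
    (M.log_hardDensity_sub (M.q_pdf _) (M.q'_pdf _) _ _) i

theorem contDiff_logRatioInt (m : Fin n) : ContDiff ℝ 1 (M.logRatioInt m) :=
  M.contDiff_logRatio (M.q_pdf _) _

theorem contDiff_logRatioInt' (m : Fin n) : ContDiff ℝ 1 (M.logRatioInt' m) :=
  M.contDiff_logRatio (M.q'_pdf _) _

theorem pd_logRatioInt_of_ne {j m : Fin n} (hjl : j ≠ M.I m) (hj : ¬ M.G.Adj j (M.I m))
    (z : Lat n) : pd (M.logRatioInt m) j z = 0 :=
  M.pd_logRatio_of_ne (M.q_pdf _) hjl hj z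

theorem pd_logRatioInt'_of_ne {j m : Fin n} (hjl : j ≠ M.I' m) (hj : ¬ M.G.Adj j (M.I' m))
    (z : Lat n) : pd (M.logRatioInt' m) j z = 0 :=
  M.pd_logRatio_of_ne (M.q'_pdf _) hjl hj z

end LatentModel

/-! ### Encoders acting componentwise -/

section Componentwise

variable {n d : ℕ} {φ ψ : Lat n → Lat n} {τ : Equiv.Perm (Fin n)}

/-- The `m`-th coordinate of `φ` depends on the `τ m`-th coordinate only. -/
def IsComponentwise (φ : Lat n → Lat n) (τ : Equiv.Perm (Fin n)) : Prop :=
  ∀ m j, j ≠ τ m → ∀ z, pd (fun y => φ y m) j z = 0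

/-- Column τ m of the invertible Jacobian has a nonzero entry, and only row m can hold it. -/
theorem IsComponentwise.pd_ne_zero (hφ : IsComponentwise φ τ) (H : IsC1Inverse φ ψ) (m : Fin n)
    (z : Lat n) : pd (fun y => φ y m) (τ m) z ≠ 0 := by
  obtain ⟨k, hk⟩ := H.exists_pd_ne_zero (τ m) z
  have : τ m = τ k := by
    by_contra hne
    exact hk (hφ k (τ m) hne z)
  rw [τ.injective this] at hk ⊢
  exact hk

theorem IsComponentwise.pd_eq_mul (hφ : IsComponentwise φ τ) (H : IsC1Inverse φ ψ)
    {L : Lat n → ℝ} (hL : Differentiable ℝ L) (i : Fin n) (z : Lat n) :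
    pd L (τ i) z = pd (fun y => φ y i) (τ i) z * pd (fun y => L (ψ y)) i (φ z) := by
  rw [H.pd_eq_sum hL, Finset.sum_eq_single i]
  · intro m _ hm
    rw [hφ m (τ i) (fun h => hm (τ.injective h).symm), zero_mul]
  · simp

theorem IsComponentwise.pd_comp_eq_zero_iff (hφ : IsComponentwise φ τ) (H : IsC1Inverse φ ψ)
    {L : Lat n → ℝ} (hL : Differentiable ℝ L) (i : Fin n) :
    (∀ y, pd (fun y => L (ψ y)) i y = 0) ↔ ∀ z, pd L (τ i) z = 0 := by
  constructor
  · intro h z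
    rw [hφ.pd_eq_mul H hL, h, mul_zero]
  · intro h y
    have := hφ.pd_eq_mul H hL i (ψ y)
    rw [h, H.right_inv] at this
    exact (mul_eq_zero.1 this.symm).resolve_left (hφ.pd_ne_zero H i _)

theorem contDiff_update {n : ℕ} (z : Lat n) (i : Fin n) :
    ContDiff ℝ 1 fun u : ℝ => Function.update z i u := by
  rw [contDiff_pi]
  intro k
  by_cases hk : k = i
  · subst hk
    simp only [Function.update_self]
    exact contDiff_id
  · simpa [Function.update_of_ne hk] using contDiff_const

theorem IsComponentwise.exists_diffeomorph (hφ : IsComponentwise φ τ) (H : IsC1Inverse φ ψ)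
    (m : Fin n) :
    ∃ f : ℝ ≃ₘ^1⟮𝓘(ℝ, ℝ), 𝓘(ℝ, ℝ)⟯ ℝ, ∀ z : Lat n, φ z m = f (z (τ m)) := by
  have hdep : ∀ (k : Fin n) {z z' : Lat n}, z (τ k) = z' (τ k) → φ z k = φ z' k :=
    fun k z z' => eq_of_pd_eq_zero (H.differentiable_coord k) (hφ k)
  -- φ maps the τ m-axis into the line through φ 0 in direction m, so restricting ψ to that line
  -- inverts the one-variable map.
  have hsingle : ∀ u : ℝ, φ (Function.update 0 (τ m) u) =
      Function.update (φ 0) m (φ (Function.update 0 (τ m) u) m) := by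
    intro u
    ext k
    by_cases hk : k = m
    · subst hk
      simp
    · rw [Function.update_of_ne hk]
      refine hdep k ?_
      rw [Function.update_of_ne fun h => hk (τ.injective h)]
  refine ⟨⟨⟨fun u => φ (Function.update 0 (τ m) u) m,
    fun y => ψ (Function.update (φ 0) m y) (τ m), fun u => ?_, fun y => ?_⟩, ?_, ?_⟩, fun z => ?_⟩
  · simp only
    rw [← hsingle, H.left_inv, Function.update_self]
  · simp only
    rw [hdep m (z' := ψ (Function.update (φ 0) m y)) (by simp), H.right_inv, Function.update_self]
  · exact ((H.contDiff_coord m).comp (contDiff_update 0 (τ m))).contMDiff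
  · exact ((H.symm.contDiff_coord (τ m)).comp (contDiff_update (φ 0) m)).contMDiff
  · exact hdep m (by simp)

namespace LatentModel

variable (M : LatentModel n d) {h : Obs d → Lat n}

theorem latentRecovery_of_isComponentwise (H : IsC1Inverse (fun z => h (M.g z)) ψ)
    (hφ : IsComponentwise (fun z => h (M.g z)) τ) : M.LatentRecovery h τ := by
  choose f hf using hφ.exists_diffeomorph H
  refine ⟨fun l => f (τ.symm l), fun z m => ?_⟩
  simp only [τ.symm_apply_apply]
  exact hf m z

theorem forall_pd_logRatio_eq_zero_iff {q : ℝ → ℝ} (hq : IsPositivePDF q) {j l : Fin n}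
    (hD : ∀ w, InterventionalDiscrepancy (fun u => M.p l u w) q) :
    (∀ z, pd (M.logRatio l q) j z = 0) ↔ ¬ (j = l ∨ M.G.Adj j l) := by
  constructor
  · rintro h0 (rfl | hj)
    · obtain ⟨z, hz⟩ := (M.dense_pd_logRatio_self hq _ hD).nonempty
      exact hz (h0 z)
    · obtain ⟨z, hz⟩ := M.exists_pd_logRatio_ne_zero hq hj
      exact hz (h0 z)
  · intro hj z
    push Not at hj
    exact M.pd_logRatio_of_ne hq hj.1 hj.2 z

theorem scoreMatrix_eq_zero_iff_of_isComponentwise (hM : M.PairwiseDiscrepancy)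
    (H : IsC1Inverse (fun z => h (M.g z)) ψ) (hφ : IsComponentwise (fun z => h (M.g z)) τ)
    (i m : Fin n) :
    M.observed.scoreMatrix h i m = 0 ↔ ¬ (τ i = M.I m ∨ M.G.Adj (τ i) (M.I m)) := by
  rw [M.scoreMatrix_eq_zero_iff H, hφ.pd_comp_eq_zero_iff H
    ((M.contDiff_logRatioInt m).differentiable one_ne_zero),
    M.forall_pd_logRatio_eq_zero_iff (M.q_pdf _) (hM _).1]

theorem scoreMatrix'_eq_zero_iff_of_isComponentwise (hM : M.PairwiseDiscrepancy)
    (H : IsC1Inverse (fun z => h (M.g z)) ψ) (hφ : IsComponentwise (fun z => h (M.g z)) τ)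
    (i m : Fin n) :
    M.observed.scoreMatrix' h i m = 0 ↔ ¬ (τ i = M.I' m ∨ M.G.Adj (τ i) (M.I' m)) := by
  rw [M.scoreMatrix'_eq_zero_iff H, hφ.pd_comp_eq_zero_iff H
    ((M.contDiff_logRatioInt' m).differentiable one_ne_zero),
    M.forall_pd_logRatio_eq_zero_iff (M.q'_pdf _) (hM _).2.1]

theorem dagRecovery_of_isComponentwise (hM : M.PairwiseDiscrepancy)
    (H : IsC1Inverse (fun z => h (M.g z)) ψ) (hφ : IsComponentwise (fun z => h (M.g z)) M.I) :
    M.DAGRecovery (M.observed.graphEstimate h) M.I := by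
  intro i m
  change (i ≠ m ∧ M.observed.scoreMatrix h i m ≠ 0) ↔ _
  rw [Ne, Ne, M.scoreMatrix_eq_zero_iff_of_isComponentwise hM H hφ, not_not,
    M.I.injective.eq_iff]
  constructor
  · rintro ⟨h1, h2⟩
    exact h2.resolve_left h1
  · intro h1
    refine ⟨?_, .inr h1⟩
    rintro rfl
    exact M.not_adj_self _ h1

end LatentModel

end Componentwise

namespace LatentModel

variable {n d : ℕ} (M : LatentModel n d) {h : Obs d → Lat n} {ψ : Lat n → Lat n}
  {π : Equiv.Perm (Fin n)}

/-! ### Comparing the two interventional sets -/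

/-- The difference of the interventional log-densities of two environments coupled by `π`. -/
noncomputable def coupledDiff (π : Equiv.Perm (Fin n)) (m : Fin n) (z : Lat n) : ℝ :=
  M.logRatioInt' (π m) z - M.logRatioInt m z

theorem contDiff_coupledDiff (π : Equiv.Perm (Fin n)) (m : Fin n) :
    ContDiff ℝ 1 (M.coupledDiff π m) :=
  (M.contDiff_logRatioInt' _).sub (M.contDiff_logRatioInt _)

theorem pd_coupledDiff (m j : Fin n) (z : Lat n) :
    pd (M.coupledDiff π m) j z = pd (M.logRatioInt' (π m)) j z - pd (M.logRatioInt m) j z :=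
  pd_sub ((M.contDiff_logRatioInt' _).differentiable one_ne_zero)
    ((M.contDiff_logRatioInt _).differentiable one_ne_zero) j z

/-- In correctly coupled environments the observational mechanisms cancel. -/
theorem coupledDiff_of_eq {m : Fin n} (hm : M.I' (π m) = M.I m) (z : Lat n) :
    M.coupledDiff π m z =
      Real.log (M.q (M.I m) (z (M.I m))) - Real.log (M.q' (M.I m) (z (M.I m))) := by
  unfold coupledDiff logRatioInt' logRatioInt logRatio
  rw [hm]
  ring

theorem pd_coupledDiff_self {m : Fin n} (hm : M.I' (π m) = M.I m) (z : Lat n) :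
    pd (M.coupledDiff π m) (M.I m) z =
      deriv (fun u => Real.log (M.q (M.I m) u) - Real.log (M.q' (M.I m) u)) (z (M.I m)) := by
  rw [pd_eq_deriv ((M.contDiff_coupledDiff π m).differentiable one_ne_zero)]
  simp only [M.coupledDiff_of_eq hm, Function.update_self]

theorem pd_coupledDiff_of_ne {m : Fin n} (hm : M.I' (π m) = M.I m) {j : Fin n} (hj : j ≠ M.I m)
    (z : Lat n) : pd (M.coupledDiff π m) j z = 0 := by
  refine pd_eq_zero_of_update ((M.contDiff_coupledDiff π m).differentiable one_ne_zero)
    (fun z t => ?_) z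
  rw [M.coupledDiff_of_eq hm, M.coupledDiff_of_eq hm, Function.update_of_ne hj.symm]

theorem dense_pd_coupledDiff_self (hM : M.PairwiseDiscrepancy) {m : Fin n}
    (hm : M.I' (π m) = M.I m) : Dense {z | pd (M.coupledDiff π m) (M.I m) z ≠ 0} := by
  refine dense_of_forall_ae_update (l := M.I m) fun z => ?_
  filter_upwards [(hM (M.I m)).2.2.ae_deriv_log
    ((M.q_pdf _).contDiff.differentiable one_ne_zero)
    ((M.q'_pdf _).contDiff.differentiable one_ne_zero) (M.q_pdf _).pos (M.q'_pdf _).pos] with u hu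
  rw [M.pd_coupledDiff_self hm, Function.update_self]
  exact hu

theorem dense_pd_coupledDiff_of_not_adj (hM : M.PairwiseDiscrepancy) {m : Fin n}
    (hm : M.I m ≠ M.I' (π m)) (hadj : ¬ M.G.Adj (M.I m) (M.I' (π m))) :
    Dense {z | pd (M.coupledDiff π m) (M.I m) z ≠ 0} := by
  convert M.dense_pd_logRatio_self (M.q_pdf (M.I m)) (M.I m) (hM _).1 using 3 with z
  rw [pd_coupledDiff, M.pd_logRatioInt'_of_ne hm hadj, zero_sub, neg_ne_zero]

theorem dense_pd_coupledDiff_of_not_adj' (hM : M.PairwiseDiscrepancy) {m : Fin n}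
    (hm : M.I' (π m) ≠ M.I m) (hadj : ¬ M.G.Adj (M.I' (π m)) (M.I m)) :
    Dense {z | pd (M.coupledDiff π m) (M.I' (π m)) z ≠ 0} := by
  convert M.dense_pd_logRatio_self (M.q'_pdf (M.I' (π m))) (M.I' (π m)) (hM _).2.1 using 3 with z
  rw [pd_coupledDiff, M.pd_logRatioInt_of_ne hm hadj, sub_zero]

/-- When the two intervened nodes differ, acyclicity makes one of them a non-parent of the other; in
that direction only one log-ratio contributes. -/
theorem exists_dense_pd_coupledDiff (hM : M.PairwiseDiscrepancy) (π : Equiv.Perm (Fin n))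
    (m : Fin n) : ∃ k, Dense {z | pd (M.coupledDiff π m) k z ≠ 0} := by
  by_cases hm : M.I' (π m) = M.I m
  · exact ⟨_, M.dense_pd_coupledDiff_self hM hm⟩
  · by_cases hadj : M.G.Adj (M.I m) (M.I' (π m))
    · exact ⟨_, M.dense_pd_coupledDiff_of_not_adj' hM hm (M.not_adj_symm hadj)⟩
    · exact ⟨_, M.dense_pd_coupledDiff_of_not_adj hM (Ne.symm hm) hadj⟩

section Diagonal

variable (H : IsC1Inverse (fun z => h (M.g z)) ψ)
  (hdiag : ∀ i m, i ≠ m → M.observed.coupledScoreMatrix h π i m = 0)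

include H hdiag

/-- If the coupled score matrix is diagonal, the gradient of `coupledDiff π m` is parallel to the
gradient of the `m`-th coordinate. -/
theorem pd_coupledDiff_eq_mul (m j : Fin n) (z : Lat n) :
    pd (M.coupledDiff π m) j z =
      pd (fun y => h (M.g y) m) j z * pd (fun y => M.coupledDiff π m (ψ y)) m (h (M.g z)) := by
  rw [H.pd_eq_sum ((M.contDiff_coupledDiff π m).differentiable one_ne_zero),
    Finset.sum_eq_single m]
  · intro i _ him
    have h0 : pd (fun y => M.coupledDiff π m (ψ y)) i (h (M.g z)) = 0 :=
      (M.coupledScoreMatrix_eq_zero_iff H π i m).1 (hdiag i m him) _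
    rw [h0, mul_zero]
  · simp

/-- The factor multiplying the gradient of the m-th coordinate is nonzero on a dense set, because
some partial derivative of the coupled difference is. -/
theorem pd_coord_eq_zero (hM : M.PairwiseDiscrepancy) {m j : Fin n}
    (hj : ∀ z, pd (M.coupledDiff π m) j z = 0) (z : Lat n) :
    pd (fun y => h (M.g y) m) j z = 0 := by
  obtain ⟨k, hk⟩ := M.exists_dense_pd_coupledDiff hM π m
  refine eq_zero_of_dense (g := fun z => pd (fun y => M.coupledDiff π m (ψ y)) m (h (M.g z)))
    (continuous_pd (H.contDiff_coord m) j) (hk.mono ?_) (fun z => ?_) z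
  · intro z hz h0
    apply hz
    rw [M.pd_coupledDiff_eq_mul H hdiag, h0, mul_zero]
  · rw [mul_comm, ← M.pd_coupledDiff_eq_mul H hdiag, hj]

theorem dense_pd_coord {m j : Fin n} (hj : Dense {z | pd (M.coupledDiff π m) j z ≠ 0}) :
    Dense {z | pd (fun y => h (M.g y) m) j z ≠ 0} := by
  refine hj.mono ?_
  intro z hz h0
  apply hz
  rw [M.pd_coupledDiff_eq_mul H hdiag, h0, zero_mul]

/-- With a correct coupling, a diagonal coupled score matrix forces a componentwise encoder. -/
theorem isComponentwise_of_isCorrectCoupling (hM : M.PairwiseDiscrepancy)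
    (hπ : M.IsCorrectCoupling π) : IsComponentwise (fun z => h (M.g z)) M.I := fun m _ hj =>
  M.pd_coord_eq_zero H hdiag hM (M.pd_coupledDiff_of_ne (hπ m) hj)

/-- The constraints and a diagonal coupled score matrix force the coupling to be correct. -/
theorem isCorrectCoupling_of_diagonal (hM : M.PairwiseDiscrepancy)
    (hpat : ∀ i m, M.observed.scoreMatrix h i m = 0 ↔ M.observed.scoreMatrix' h i (π m) = 0)
    (hself : ∀ m, M.observed.scoreMatrix h m m ≠ 0)
    (hcycle : ∀ i m, i ≠ m →
      M.observed.scoreMatrix h i m = 0 ∨ M.observed.scoreMatrix h m i = 0) :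
    M.IsCorrectCoupling π := by
  by_contra hcon
  simp only [IsCorrectCoupling, not_forall] at hcon
  obtain ⟨m₀, hm₀⟩ := hcon
  -- A miscoupled node with no miscoupled child.
  obtain ⟨a, ha, hchild⟩ := M.exists_forall_not_adj
    (A := {a | M.I' (π (M.I.symm a)) ≠ a}) ⟨M.I m₀, by simpa using hm₀⟩
  -- The miscoupled nodes are the non-fixed points of the permutation I' ∘ π ∘ I⁻¹, which maps this
  -- set to itself; so both nodes of a miscoupled pair belong to it.
  have hB : ∀ m, M.I' (π m) ≠ M.I m → ¬ M.G.Adj a (M.I m) ∧ ¬ M.G.Adj a (M.I' (π m)) := by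
    intro m hm
    refine ⟨hchild _ (by simpa using hm), hchild _ fun heq => hm ?_⟩
    have := π.injective (M.I'.injective heq)
    rw [Equiv.symm_apply_eq] at this
    exact this
  obtain ⟨s, rfl⟩ := M.I.surjective a
  obtain ⟨t, ht⟩ : ∃ t, M.I' (π t) = M.I s :=
    ⟨π.symm (M.I'.symm (M.I s)), by simp⟩
  have hs : M.I' (π s) ≠ M.I s := by simpa using ha
  have hst : s ≠ t := by
    rintro rfl
    exact hs ht
  have htI : M.I t ≠ M.I s := fun h => hst (M.I.injective h).symm
  have htI' : M.I' (π t) ≠ M.I t := by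
    rw [ht]
    exact htI.symm
  -- Away from s and t no coupled difference involves z_a, where a = I s = I'(π t).
  have hother : ∀ m, m ≠ s → m ≠ t → ∀ z, pd (fun y => h (M.g y) m) (M.I s) z = 0 := by
    intro m hms hmt
    have h1 : M.I s ≠ M.I m := fun h => hms (M.I.injective h).symm
    have h2 : M.I s ≠ M.I' (π m) := fun h => hmt (π.injective (M.I'.injective (ht.trans h))).symm
    refine M.pd_coord_eq_zero H hdiag hM fun z => ?_
    by_cases hm : M.I' (π m) = M.I m
    · exact M.pd_coupledDiff_of_ne hm h1 z
    · rw [pd_coupledDiff, M.pd_logRatioInt_of_ne h1 (hB m hm).1,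
        M.pd_logRatioInt'_of_ne h2 (hB m hm).2, sub_zero]
  -- For L independent of z_a only two terms of the chain rule survive. Both coefficients are
  -- nonzero on dense sets (`hds`, `hdt`), so the ẑ_s- and ẑ_t-derivatives of L vanish together.
  have hchain : ∀ {L : Lat n → ℝ}, ContDiff ℝ 1 L → (∀ z, pd L (M.I s) z = 0) → ∀ z,
      pd (fun y => h (M.g y) s) (M.I s) z * pd (fun y => L (ψ y)) s (h (M.g z)) +
        pd (fun y => h (M.g y) t) (M.I s) z * pd (fun y => L (ψ y)) t (h (M.g z)) = 0 := by
    intro L hL h0 z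
    have h1 := H.pd_eq_sum (hL.differentiable one_ne_zero) (M.I s) z
    rw [h0, ← Finset.sum_subset (Finset.subset_univ {s, t}), Finset.sum_pair hst] at h1
    · exact h1.symm
    · intro m _ hm
      simp only [Finset.mem_insert, Finset.mem_singleton, not_or] at hm
      rw [hother m hm.1 hm.2, zero_mul]
  have hcont : ∀ {L : Lat n → ℝ}, ContDiff ℝ 1 L → ∀ m,
      Continuous fun z => pd (fun y => L (ψ y)) m (h (M.g z)) := fun hL m =>
    (continuous_pd (hL.comp H.contDiff_inv) m).comp H.contDiff.continuous
  have hsurj : ∀ {L : Lat n → ℝ} {m}, (∀ z, pd (fun y => L (ψ y)) m (h (M.g z)) = 0) →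
      ∀ y, pd (fun y => L (ψ y)) m y = 0 := by
    intro L m h0 y
    have := h0 (ψ y)
    rwa [H.right_inv y] at this
  have hds : Dense {z | pd (fun y => h (M.g y) s) (M.I s) z ≠ 0} :=
    M.dense_pd_coord H hdiag (M.dense_pd_coupledDiff_of_not_adj hM hs.symm (hB s hs).2)
  have hdt : Dense {z | pd (fun y => h (M.g y) t) (M.I s) z ≠ 0} := by
    refine M.dense_pd_coord H hdiag ?_
    rw [← ht]
    refine M.dense_pd_coupledDiff_of_not_adj' hM htI' ?_
    rw [ht]
    exact (hB t htI').1
  -- A zero (s, t) entry would force a zero (t, t) entry, so the 2-cycle constraint puts the zero at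
  -- (t, s).
  have hts : M.observed.scoreMatrix h t s = 0 := by
    refine (hcycle t s hst.symm).resolve_right fun h0 => hself t ?_
    rw [M.scoreMatrix_eq_zero_iff H] at h0 ⊢
    refine hsurj (eq_zero_of_dense (hcont (M.contDiff_logRatioInt t) t) hdt fun z => ?_)
    have := hchain (M.contDiff_logRatioInt t)
      (M.pd_logRatioInt_of_ne htI.symm (hB t htI').1) z
    rwa [h0, mul_zero, zero_add] at this
  -- The pattern constraint moves the zero at (t, s) to the second set, where it spreads from row t
  -- to row s; moving back gives a zero on the diagonal.
  apply hself s
  rw [hpat] at hts ⊢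
  rw [M.scoreMatrix'_eq_zero_iff H] at hts ⊢
  refine hsurj (eq_zero_of_dense (hcont (M.contDiff_logRatioInt' (π s)) s) hds fun z => ?_)
  have := hchain (M.contDiff_logRatioInt' (π s))
    (M.pd_logRatioInt'_of_ne hs.symm (hB s hs).2) z
  rwa [hts, mul_zero, add_zero] at this

end Diagonal

/-- Feasible candidates of objective value zero recover the latent model. -/
theorem recovery_of_objective_eq_zero (hM : M.PairwiseDiscrepancy) {lam : ℝ}
    {c : ObservedData.Candidate n d} (hc : M.observed.IsFeasible c)
    (h0 : M.observed.objective lam c = 0) :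
    M.IsCorrectCoupling c.π ∧ M.DAGRecovery (M.observed.graphEstimate c.h) M.I ∧
      M.LatentRecovery c.h M.I := by
  obtain ⟨ψ, H⟩ := hc.encoder.exists_isC1Inverse M.g_diffeo
  have hdiag : ∀ i m, i ≠ m → M.observed.coupledScoreMatrix c.h c.π i m = 0 := by
    intro i m him
    rw [((M.observed.objective_eq_zero_iff lam c).1 h0).1, Matrix.one_apply_ne him]
  obtain ⟨hself, hcycle⟩ := (nonzeroPattern_hadamard_transpose_eq_one_iff _).1 hc.no_two_cycles
  have hπ := M.isCorrectCoupling_of_diagonal H hdiag hM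
    ((nonzeroPattern_eq_mul_permMatrix_iff _ _ _).1 hc.coupling) hself hcycle
  have hφ := M.isComponentwise_of_isCorrectCoupling H hdiag hM hπ
  exact ⟨hπ, M.dagRecovery_of_isComponentwise hM H hφ, M.latentRecovery_of_isComponentwise H hφ⟩

end LatentModel

/-! ### Existence of an encoder of objective value zero -/

/-- A continuous function bounded below by a positive constant is the derivative of a `C¹`
diffeomorphism of the line. -/
theorem exists_diffeo_deriv_eq {w : ℝ → ℝ} (hw : Continuous w) {c : ℝ} (hc : 0 < c)
    (hcw : ∀ u, c ≤ w u) :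
    ∃ f k : ℝ → ℝ, ContDiff ℝ 1 f ∧ ContDiff ℝ 1 k ∧ (∀ u, k (f u) = u) ∧ (∀ v, f (k v) = v) ∧
      ∀ u, deriv f u = w u := by
  let f : ℝ → ℝ := fun u => ∫ x in (0 : ℝ)..u, w x
  have hd : ∀ u, HasDerivAt f (w u) u := fun u => (hw.integral_hasStrictDerivAt 0 u).hasDerivAt
  have hderiv : deriv f = w := funext fun u => (hd u).deriv
  have hdiff : Differentiable ℝ f := fun u => (hd u).differentiableAt
  have hf : ContDiff ℝ 1 f := contDiff_one_iff_deriv.2 ⟨hdiff, hderiv ▸ hw⟩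
  have hmono : StrictMono f := strictMono_of_deriv_pos fun u => by
    rw [hderiv]
    exact hc.trans_le (hcw u)
  -- The lower bound c gives f at least linear growth in both directions, hence surjectivity.
  have hlin : Monotone fun u => f u - c * u := by
    refine monotone_of_deriv_nonneg (hdiff.sub ((differentiable_const c).mul differentiable_id))
      fun u => ?_
    have := (hd u).sub ((hasDerivAt_id u).const_mul c)
    have e : deriv (fun u => f u - c * u) u = w u - c * 1 := this.deriv
    rw [e, mul_one]
    exact sub_nonneg.2 (hcw u)
  have hf0 : f 0 = 0 := by simp [f]
  have htop : Filter.Tendsto f Filter.atTop Filter.atTop := by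
    refine Filter.tendsto_atTop_mono' _ ?_ (Filter.tendsto_id.const_mul_atTop hc)
    filter_upwards [Filter.eventually_ge_atTop 0] with u hu
    have := hlin hu
    simp only [hf0, mul_zero, sub_zero] at this
    simpa using this
  have hbot : Filter.Tendsto f Filter.atBot Filter.atBot := by
    refine Filter.tendsto_atBot_mono' _ ?_ (Filter.tendsto_id.const_mul_atBot hc)
    filter_upwards [Filter.eventually_le_atBot 0] with u hu
    have := hlin hu
    simp only [hf0, mul_zero, sub_zero] at this
    simpa using this
  have hsurj : Function.Surjective f := hf.continuous.surjective htop hbot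
  let e : ℝ ≃ₜ ℝ := (hmono.orderIsoOfSurjective f hsurj).toHomeomorph
  have he : ∀ u, e u = f u := fun u => rfl
  refine ⟨f, e.symm, hf, ?_, fun u => ?_, fun v => ?_, fun u => by rw [hderiv]⟩
  · exact e.contDiff_symm_deriv (fun x => (hc.trans_le (hcw x)).ne') hd hf
  · rw [← he, e.symm_apply_apply]
  · rw [← he, e.apply_symm_apply]

section

variable {n d : ℕ} {φ ψ : Lat n → Lat n}

theorem IsC1Inverse.isDiffeoOntoImage_comp {g : Lat n → Obs d} (hg : IsDiffeoOntoImage g)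
    (H : IsC1Inverse φ ψ) : IsDiffeoOntoImage fun y => g (ψ y) where
  contDiff := hg.contDiff.comp H.contDiff_inv
  isEmbedding := by
    let e : Lat n ≃ₜ Lat n :=
      ⟨⟨ψ, φ, H.right_inv, H.left_inv⟩, H.contDiff_inv.continuous, H.contDiff.continuous⟩
    exact hg.isEmbedding.comp e.isEmbedding
  injective_fderiv z := by
    have h1 := ((hg.contDiff.differentiable one_ne_zero (ψ z)).hasFDerivAt).comp z
      (H.contDiff_inv.differentiable one_ne_zero z).hasFDerivAt
    have h2 : fderiv ℝ (fun y => g (ψ y)) z = (fderiv ℝ g (ψ z)).comp (fderiv ℝ ψ z) := h1.fderiv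
    rw [h2]
    refine (hg.injective_fderiv (ψ z)).comp ?_
    refine Function.LeftInverse.injective (g := fderiv ℝ φ (ψ z)) fun v => ?_
    exact congrArg (fun A : Lat n →L[ℝ] Lat n => A v) (H.symm.fderiv_comp z)

theorem IsC1Inverse.of_componentwise {f k : Fin n → ℝ → ℝ} (τ : Equiv.Perm (Fin n))
    (hf : ∀ l, ContDiff ℝ 1 (f l)) (hk : ∀ l, ContDiff ℝ 1 (k l)) (hkf : ∀ l u, k l (f l u) = u)
    (hfk : ∀ l v, f l (k l v) = v) :
    IsC1Inverse (fun (z : Lat n) m => f (τ m) (z (τ m))) fun y l => k l (y (τ.symm l)) where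
  contDiff := contDiff_pi.2 fun m => (hf _).comp (contDiff_apply ℝ ℝ (τ m))
  contDiff_inv := contDiff_pi.2 fun l => (hk _).comp (contDiff_apply ℝ ℝ (τ.symm l))
  left_inv z := by
    ext l
    simp [hkf]
  right_inv y := by
    ext m
    simp [hfk]

theorem pd_comp_eval {f : ℝ → ℝ} (hf : ContDiff ℝ 1 f) (l j : Fin n) (z : Lat n) :
    pd (fun z => f (z l)) j z = if j = l then deriv f (z l) else 0 := by
  have hd : Differentiable ℝ fun z : Lat n => f (z l) :=
    (hf.comp (contDiff_apply ℝ ℝ l)).differentiable one_ne_zero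
  split_ifs with h
  · subst h
    rw [pd_eq_deriv hd]
    simp only [Function.update_self]
  · refine pd_eq_zero_of_update hd (fun z t => ?_) z
    rw [Function.update_of_ne (Ne.symm h)]

end

namespace LatentModel

variable {n d : ℕ} (M : LatentModel n d)

/-- A continuous function of `Z l` that is not almost everywhere zero can be rescaled by the
derivative of a diffeomorphism so as to have absolute first moment one. -/
theorem exists_diffeo_lintegral_eq_one (l : Fin n) {a : ℝ → ℝ} (ha : Continuous a)
    (h0 : ∃ u, a u ≠ 0) :
    ∃ f k : ℝ → ℝ, ContDiff ℝ 1 f ∧ ContDiff ℝ 1 k ∧ (∀ u, k (f u) = u) ∧ (∀ v, f (k v) = v) ∧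
      ∫⁻ z, ENNReal.ofReal (M.density z) * ‖a (z l) / deriv f (z l)‖ₑ = 1 := by
  have hpos : ∀ u, 0 < 1 + |a u| := fun u => by positivity
  -- The first moment of a may be infinite; dividing by 1 + |a| makes it at most one without
  -- changing the zeros.
  let b : ℝ → ℝ := fun u => a u / (1 + |a u|)
  have hb : Continuous b := ha.div (continuous_const.add ha.abs) fun u => (hpos u).ne'
  have hρ : Measurable fun z => ENNReal.ofReal (M.density z) :=
    M.continuous_density.measurable.ennreal_ofReal
  have hbl : Continuous fun z : Lat n => b (z l) := hb.comp (continuous_apply l)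
  set C : ℝ≥0∞ := ∫⁻ z, ENNReal.ofReal (M.density z) * ‖b (z l)‖ₑ with hC
  have hb1 : ∀ u, ‖b u‖ₑ ≤ 1 := by
    intro u
    rw [Real.enorm_eq_ofReal_abs, ENNReal.ofReal_le_one, abs_div, abs_of_pos (hpos u),
      div_le_one (hpos u)]
    linarith
  have hC1 : C ≤ 1 := by
    rw [← M.lintegral_density]
    refine lintegral_mono fun z => ?_
    calc _ ≤ ENNReal.ofReal (M.density z) * 1 := by gcongr; exact hb1 _
      _ = _ := mul_one _
  have hCtop : C ≠ ⊤ := ne_top_of_le_ne_top ENNReal.one_ne_top hC1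
  have hm : Measurable fun z : Lat n => ENNReal.ofReal (M.density z) * ‖b (z l)‖ₑ :=
    hρ.mul hbl.measurable.enorm
  have hC0 : C ≠ 0 := by
    intro hz
    rw [hC, lintegral_eq_zero_iff hm] at hz
    have : (fun z : Lat n => b (z l)) =ᵐ[volume] fun _ => 0 := by
      filter_upwards [hz] with z hz
      have hz' : ENNReal.ofReal (M.density z) * ‖b (z l)‖ₑ = 0 := hz
      rcases mul_eq_zero.1 hz' with h' | h'
      · exact absurd (ENNReal.ofReal_eq_zero.1 h') (not_le.2 (M.density_pos z))
      · exact enorm_eq_zero.1 h'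
    have hall := (Continuous.ae_eq_iff_eq volume hbl continuous_const).1 this
    obtain ⟨u, hu⟩ := h0
    have := congrFun hall fun _ => u
    exact hu ((div_eq_zero_iff.1 this).resolve_right (hpos u).ne')
  have hc : 0 < C.toReal := ENNReal.toReal_pos hC0 hCtop
  -- With f' = C (1 + |a|) one gets a / f' = b / C, whose absolute first moment is one; moreover f'
  -- ≥ C > 0.
  obtain ⟨f, k, hf, hk, hkf, hfk, hd⟩ := exists_diffeo_deriv_eq
    (w := fun u => C.toReal * (1 + |a u|)) (continuous_const.mul (continuous_const.add ha.abs)) hc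
    fun u => le_mul_of_one_le_right hc.le (by linarith [abs_nonneg (a u)])
  refine ⟨f, k, hf, hk, hkf, hfk, ?_⟩
  have e : ∀ z : Lat n, ENNReal.ofReal (M.density z) * ‖a (z l) / deriv f (z l)‖ₑ =
      C⁻¹ * (ENNReal.ofReal (M.density z) * ‖b (z l)‖ₑ) := by
    intro z
    have e1 : a (z l) / deriv f (z l) = C.toReal⁻¹ * b (z l) := by
      rw [hd]
      simp only [b]
      field_simp
    have e2 : ‖C.toReal⁻¹‖ₑ = C⁻¹ := by
      rw [Real.enorm_eq_ofReal (inv_nonneg.2 hc.le), ENNReal.ofReal_inv_of_pos hc,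
        ENNReal.ofReal_toReal hCtop]
    rw [e1, enorm_mul, e2]
    ring
  simp only [e]
  rw [lintegral_const_mul _ hm, ← hC, ENNReal.inv_mul_cancel hC0 hCtop]

/-- Invert g, relabel by I, and stretch each coordinate so that the derivative of log q − log q̃ in
the new coordinate has absolute mean one. Decoding by g ∘ ψ is exact, so one candidate serves every
`lam`. -/
theorem exists_isFeasible_objective_eq_zero (hM : M.PairwiseDiscrepancy) :
    ∃ c, M.observed.IsFeasible c ∧ ∀ lam, M.observed.objective lam c = 0 := by
  classical
  let L : Fin n → ℝ → ℝ := fun l u => Real.log (M.q l u) - Real.log (M.q' l u)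
  have hL : ∀ l, ContDiff ℝ 1 (L l) := fun l =>
    ((M.q_pdf l).contDiff.log fun u => ((M.q_pdf l).pos u).ne').sub
      ((M.q'_pdf l).contDiff.log fun u => ((M.q'_pdf l).pos u).ne')
  have hL0 : ∀ l, ∃ u, deriv (L l) u ≠ 0 := fun l =>
    (Measure.dense_of_ae ((hM l).2.2.ae_deriv_log
      ((M.q_pdf l).contDiff.differentiable one_ne_zero)
      ((M.q'_pdf l).contDiff.differentiable one_ne_zero) (M.q_pdf l).pos (M.q'_pdf l).pos)).nonempty
  choose f k hf hk hkf hfk hint using fun l =>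
    M.exists_diffeo_lintegral_eq_one l (contDiff_one_iff_deriv.1 (hL l)).2 (hL0 l)
  let φ : Lat n → Lat n := fun z m => f (M.I m) (z (M.I m))
  let ψ : Lat n → Lat n := fun y l => k l (y (M.I.symm l))
  have Hφ : IsC1Inverse φ ψ := .of_componentwise M.I hf hk hkf hfk
  let h : Obs d → Lat n := fun x => φ (Function.invFun M.g x)
  have hg : ∀ z, h (M.g z) = φ z := fun z =>
    congrArg φ (Function.leftInverse_invFun M.g_diffeo.isEmbedding.injective z)
  have H : IsC1Inverse (fun z => h (M.g z)) ψ := by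
    simpa only [hg] using Hφ
  have hcw : IsComponentwise (fun z => h (M.g z)) M.I := by
    simp only [hg]
    intro m j hj z
    exact (pd_comp_eval (hf (M.I m)) (M.I m) j z).trans (if_neg hj)
  let π : Equiv.Perm (Fin n) := M.I.trans M.I'.symm
  have hπ : ∀ m, M.I' (π m) = M.I m := fun m => by simp [π]
  refine ⟨⟨h, fun y => M.g (ψ y), π⟩, ⟨?_, ?_, ?_, ?_⟩, fun lam => ?_⟩
  · refine ⟨fun y => M.g (ψ y), Hφ.isDiffeoOntoImage_comp M.g_diffeo, ?_, fun y => ?_⟩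
    · exact (Function.LeftInverse.surjective Hφ.left_inv).range_comp M.g
    · exact (hg (ψ y)).trans (Hφ.right_inv y)
  · exact (M.g_diffeo.contDiff.continuous.comp Hφ.contDiff_inv.continuous).measurable
  · rw [nonzeroPattern_eq_mul_permMatrix_iff]
    intro i m
    rw [M.scoreMatrix_eq_zero_iff_of_isComponentwise hM H hcw,
      M.scoreMatrix'_eq_zero_iff_of_isComponentwise hM H hcw, hπ]
  · rw [nonzeroPattern_hadamard_transpose_eq_one_iff]
    simp only [Ne, M.scoreMatrix_eq_zero_iff_of_isComponentwise hM H hcw]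
    refine ⟨fun m => by simp, fun i m him => ?_⟩
    by_contra! hcon
    have h1 := hcon.1.resolve_left fun h => him (M.I.injective h)
    have h2 := hcon.2.resolve_left fun h => him (M.I.injective h).symm
    exact M.not_adj_symm h1 h2
  · rw [ObservedData.objective_eq_zero_iff]
    constructor
    · ext i m : 2
      by_cases him : i = m
      · subst him
        rw [Matrix.one_apply_eq, ← hint (M.I i)]
        refine (scoreChange_law M H M.continuous_density
          (M.continuous_hardDensity (M.q_pdf _) _) (M.continuous_hardDensity (M.q'_pdf _) _)
          (M.hardDensity_pos (M.q_pdf _) _) (M.hardDensity_pos (M.q'_pdf _) _) i).trans ?_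
        refine lintegral_congr fun z => ?_
        simp only [M.log_hardDensity_sub (M.q_pdf _) (M.q'_pdf _)]
        congr 2
        have h1 := hcw.pd_eq_mul H
          ((M.contDiff_coupledDiff π i).differentiable one_ne_zero) i z
        rw [M.pd_coupledDiff_self (hπ i)] at h1
        have h2 : pd (fun y => h (M.g y) i) (M.I i) z = deriv (f (M.I i)) (z (M.I i)) := by
          simp only [hg]
          exact (pd_comp_eval (hf (M.I i)) (M.I i) (M.I i) z).trans (if_pos rfl)
        have h3 := hcw.pd_ne_zero H i z
        rw [h2] at h1 h3
        rw [eq_div_iff h3, mul_comm]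
        exact h1.symm
      · rw [Matrix.one_apply_ne him]
        refine (M.coupledScoreMatrix_eq_zero_iff H π i m).2 ?_
        refine (hcw.pd_comp_eq_zero_iff H
          ((M.contDiff_coupledDiff π m).differentiable one_ne_zero) i).2 ?_
        exact M.pd_coupledDiff_of_ne (hπ m) fun h => him (M.I.injective h)
    · have hemb : MeasurableEmbedding M.g :=
        M.g_diffeo.contDiff.continuous.measurableEmbedding M.g_diffeo.isEmbedding.injective
      have e : ∫⁻ x, ‖M.g (ψ (h x)) - x‖ₑ ^ 2 ∂M.observed.obs = 0 := by
        refine (hemb.lintegral_map _).trans ?_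
        simp [hg, Hφ.left_inv]
      simp only [e, mul_zero]

end LatentModel

end CRL

/-! ### Conclusion: the estimator and the minimisers. -/

theorem mainTheorem5 (n d : ℕ) :
    (∃ est : CRL.ObservedData n d → (CRL.Obs d → CRL.Lat n) × Digraph (Fin n),
      ∀ M : CRL.LatentModel n d, M.PairwiseDiscrepancy →
        ∃ τ : Equiv.Perm (Fin n),
          M.DAGRecovery (est M.observed).2 τ ∧ M.LatentRecovery (est M.observed).1 τ) ∧
    (∀ M : CRL.LatentModel n d, M.PairwiseDiscrepancy → ∀ lam : ℝ, 0 ≤ lam →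
      (∃ c, M.observed.IsMinimizer lam c ∧ M.observed.objective lam c = 0) ∧
      ∀ c, M.observed.IsMinimizer lam c →
        M.observed.objective lam c = 0 ∧
        M.IsCorrectCoupling c.π ∧
        M.DAGRecovery (M.observed.graphEstimate c.h) M.I ∧
        M.LatentRecovery c.h M.I) := by
  classical
  constructor
  -- The estimator selects any feasible candidate of value zero, a property of the observed data
  -- alone. The fallback value is never reached on data from a model satisfying the assumptions.
  · refine ⟨fun D => if hD : ∃ c, D.IsFeasible c ∧ D.objective 0 c = 0
      then (hD.choose.h, D.graphEstimate hD.choose.h) else (fun _ => 0, ⊥), fun M hM => ?_⟩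
    have hD : ∃ c, M.observed.IsFeasible c ∧ M.observed.objective 0 c = 0 := by
      obtain ⟨c, hc, h0⟩ := M.exists_isFeasible_objective_eq_zero hM
      exact ⟨c, hc, h0 0⟩
    obtain ⟨hc, h0⟩ := hD.choose_spec
    refine ⟨M.I, ?_⟩
    simp only [dif_pos hD]
    exact (M.recovery_of_objective_eq_zero hM hc h0).2
  · intro M hM lam _
    obtain ⟨c₀, hc₀, h0⟩ := M.exists_isFeasible_objective_eq_zero hM
    refine ⟨⟨c₀, ⟨hc₀, fun c' _ => by rw [h0]; exact zero_le⟩, h0 lam⟩, fun c hc => ?_⟩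
    have hc0 : M.observed.objective lam c = 0 := by
      have := hc.2 c₀ hc₀
      rw [h0] at this
      exact le_antisymm this zero_le
    exact ⟨hc0, M.recovery_of_objective_eq_zero hM hc.1 hc0⟩
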